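/- Let $\mathcal M=(\mathcal S,\mathcal A,H,P)$ be an episodic MDP with finite state space $\mathcal S$, finite action space $\mathcal A$ and layers $\mathcal S=\mathcal S_1\sqcup\dots\sqcup\mathcal S_H$: the initial state lies in $\mathcal S_1$ (fixed, or drawn from a fixed law), for $h<H$ and $s\in\mathcal S_h$ the distribution $P(\cdot|s,a)$ is carried by $\mathcal S_{h+1}$, and from $\mathcal S_H$ the process moves to an end state outside $\mathcal S$. A learner interacts with $\mathcal M$ in epochs $t=1,\dots,T$: in epoch $t$ it chooses a stochastic policy $\pi_t$ measurable with respect to the information $\mathcal F_{t-1}$ available after epoch $t-1$ (past trajectories, and possibly losses and internal randomness), and given $\mathcal F_{t-1}$ the trajectory $o_t=(s_1,a_1,\dots,s_H,a_H)$ is generated by $\pi_t$ and $P$. Let $\delta\in(0,1)$ and $\epsilon\ge 0$. *Pruned space.* For $B\subseteq\mathcal S$ let the pruned space be $B\cup\{s_1^\bot,\dots,s_H^\bot\}$ with auxiliary states $s_h^\bot$ in layer $h$. Its true transition function $P^\bot$ is: for $s\in B\cap\mathcal S_h$, $P^\bot(s'|s,a)=P(s'|s,a)$ if $s'\in B\cap\mathcal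 S_{h+1}$ and $P^\bot(s_{h+1}^\bot|s,a)=1-\sum_{r\in B\cap \mathcal S_{h+1}}P(r|s,a)$; and $P^\bot(s'|s_h^\bot,a)=\mathbb 1\{s'=s_{h+1}^\bot\}$. The algorithm SF-RL starts with $B=\emptyset$; after epoch $t$, with $n_t(s)$ the number of visits of $s$ in epochs $1,\dots,t$, if some $s\in o_t\setminus B$ has $\frac{n_t(s)}2-\frac12\log\frac{2H^2t^2}{\delta}-\frac12>\epsilon t$, then it adds to $B$ all $s$ with $\frac{n_t(s)}2-\frac12\log\frac{2H^2t^2}{\delta}-1>\epsilon t$. Let $\mathcal S_t^\bot$ be its pruned space at the beginning of epoch $t$ and $P_t^\bot$ the true transition function on it. *Confidence set.* Let $t(s)$ be the first epoch in which $s$ is visited ($\infty$ if none), $t(s,s')=\max\{t(s),t(s')\}$, $i(s)$ the index of $s$ when states are sorted by time of first arrival (within an epoch, by horizon), and $\mathcal S_t^\Pi$ the set of states visited before epoch $t$. Let $N_t(s,a)$, $M_t(s'|s,a)$ be the numbers of visits of $(s,a)$ and of $(s,a,s')$ under one of two conventions, fixed throughout: in epochs $1,\dots,t-1$, or in epochs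 $1,\dots,t$. Put $$\bar P_t^{t'}(s'|s,a)=\frac{M_t(s'|s,a)-M_{t'}(s'|s,a)}{\max\{1,N_t(s,a)-N_{t'}(s,a)\}},\qquad \delta(s,a)=\frac{\delta}{4\,i(s)^2|\mathcal A|},\qquad \delta(s,a,s')=\frac{\delta}{4\,(i(s)^4+i(s')^4)|\mathcal A|},$$ $$\epsilon_t^1(s'|s,a)=4\sqrt{\frac{\bar P_t^{t(s,s')}(s'|s,a)\log\frac{t}{\delta(s,a,s')}}{\max\{N_t(s,a)-N_{t(s,s')}(s,a)-1,1\}}}+\frac{20\log\frac{t}{\delta(s,a,s')}}{\max\{N_t(s,a)-N_{t(s,s')}(s,a)-1,1\}},$$ $$\epsilon_t^2(s'|s,a)=\frac{2|\mathcal S^\Pi_{t(s')}|+24\log\frac{t}{\delta(s,a)}}{\max\{N_{t(s')}(s,a)-1,1\}},$$ $\mathcal I_t^1(s'|s,a)=[\bar P_t^{t(s,s')}(s'|s,a)\pm\epsilon_t^1(s'|s,a)]$, and $\mathcal I_t^2(s'|s,a)=[0,\epsilon_t^2(s'|s,a)]$ if $t(s')\ge t(s)+1$, $\mathcal I_t^2(s'|s,a)=[0,1]$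 otherwise. For a pruned space with non-auxiliary states $B$, let $\mathcal P_t^\bot$ be the set of all (layered) transition functions $\hat P$ on it such that $\hat P(s'|s,a)\in\mathcal I_t^1(s'|s,a)\cap\mathcal I_t^2(s'|s,a)$ for all $h$, $s\in B\cap\mathcal S_h$, $a\in\mathcal A$, $s'\in B\cap\mathcal S_{h+1}$, and $\hat P(s'|s_h^\bot,a)=\mathbb 1\{s'=s_{h+1}^\bot\}$ for all $h$, $a$ and all $s'$ of the pruned space in layer $h+1$. *Claim.* Under either convention for the counts, with probability at least $1-\delta$, for all $t\in[T]$: $P_t^\bot\in\mathcal P_t^\bot$ for the pruned space $\mathcal S_t^\bot$ of SF-RL; and, on the same event, the true transition function $P^\bot$ lies in $\mathcal P_t^\bot$ for every pruned space whose non-auxiliary states have all been visited before epoch $t$. -/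

import Mathlib

open MeasureTheory

noncomputable section

namespace StateFreeRL

/-- A trajectory `(s_1, a_1, …, s_H, a_H)` of one epoch; `h : Fin H` stands for horizon `h + 1`. -/
abbrev Traj (S A : Type*) (H : ℕ) := Fin H → S × A

/-- A layered episodic MDP with finitely many states. `layer s = h` means that `s` belongs to
horizon `h + 1`. The artificial end state after the last horizon is not an element of `S`, so
the rows of `P` at the last horizon are zero. The first state of every epoch has law `init`
(a point mass if the initial state is fixed). -/
structure LayeredMDP (S A : Type*) [Fintype S] (H : ℕ) where
  layer : S → Fin H
  init : S → ℝ
  init_nonneg : ∀ s, 0 ≤ init s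
  init_sum : ∑ s, init s = 1
  init_layer : ∀ s, init s ≠ 0 → (layer s : ℕ) = 0
  P : S → A → S → ℝ
  P_nonneg : ∀ s a s', 0 ≤ P s a s'
  P_layer : ∀ s a s', P s a s' ≠ 0 → (layer s' : ℕ) = layer s + 1
  P_sum : ∀ s a, (layer s : ℕ) + 1 < H → ∑ s', P s a s' = 1

section Protocol

variable {S A : Type*} [Fintype S] {H : ℕ}

/-- Probability of the trajectory `o` when the (stochastic, stationary) policy `π` is executed. -/
def LayeredMDP.trajProb (M : LayeredMDP S A H) (π : S → A → ℝ) (o : Traj S A H) : ℝ :=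
  ∏ h : Fin H,
    (if (h : ℕ) = 0 then M.init (o h).1
      else M.P (o ⟨h - 1, by omega⟩).1 (o ⟨h - 1, by omega⟩).2 (o h).1) *
    π (o h).1 (o h).2

/-- The interaction of a learner with the MDP in epochs `1, …, T`. `𝓕 t` is the information
available after epoch `t` (it may contain losses, whether stochastic or chosen by an adaptive
adversary, and internal randomness of the learner). At the beginning of epoch `t` the learner picks
a policy `π t` on the basis of `𝓕 (t - 1)`; given `𝓕 (t - 1)`, the trajectory `x t` is then
generated by `π t` and the transition function. -/
structure IsInteraction [Fintype A] {Ω : Type*} {mΩ : MeasurableSpace Ω} (M : LayeredMDP S A H)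
    (T : ℕ) (μ : Measure Ω) (𝓕 : Filtration ℕ mΩ) (π : ℕ → Ω → S → A → ℝ)
    (x : ℕ → Ω → Traj S A H) : Prop where
  policy_mem : ∀ t ω s, π t ω s ∈ stdSimplex ℝ A
  policy_measurable : ∀ t, 1 ≤ t → ∀ s a, Measurable[𝓕 (t - 1)] (fun ω => π t ω s a)
  traj_measurable : ∀ t, 1 ≤ t → ∀ o, MeasurableSet[𝓕 t] {ω | x t ω = o}
  traj_law : ∀ t, 1 ≤ t → t ≤ T → ∀ o,
    μ[Set.indicator {ω | x t ω = o} (fun _ => (1 : ℝ)) | 𝓕 (t - 1)]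
      =ᵐ[μ] fun ω => M.trajProb (π t ω) o

end Protocol

section Path

/- In this section `x : ℕ → Traj S A H` is a realized sequence of trajectories; `x t` is the
trajectory of epoch `t`, and only `t ≥ 1` is used. -/

variable {S A : Type*} {H : ℕ}

/-- State `s` occurs in the trajectory. -/
def Visits (o : Traj S A H) (s : S) : Prop := ∃ h, (o h).1 = s

/-- The pair `(s, a)` occurs in the trajectory. -/
def VisitsSA (o : Traj S A H) (s : S) (a : A) : Prop := ∃ h, o h = (s, a)

/-- The transition `(s, a, s')` occurs in the trajectory. -/
def VisitsSAS (o : Traj S A H) (s : S) (a : A) (s' : S) : Prop :=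
  ∃ h h' : Fin H, (h' : ℕ) = h + 1 ∧ o h = (s, a) ∧ (o h').1 = s'

open Classical in
/-- Number of visits of `s` in epochs `1, …, n`. (In a layered MDP a state, a state-action pair
or a transition is visited at most once per epoch.) -/
def countS (x : ℕ → Traj S A H) (n : ℕ) (s : S) : ℕ :=
  ((Finset.Icc 1 n).filter fun τ => Visits (x τ) s).card

open Classical in
/-- Number of visits of `(s, a)` in epochs `1, …, n`. -/
def countSA (x : ℕ → Traj S A H) (n : ℕ) (s : S) (a : A) : ℕ :=
  ((Finset.Icc 1 n).filter fun τ => VisitsSA (x τ) s a).card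

open Classical in
/-- Number of visits of `(s, a, s')` in epochs `1, …, n`. -/
def countSAS (x : ℕ → Traj S A H) (n : ℕ) (s : S) (a : A) (s' : S) : ℕ :=
  ((Finset.Icc 1 n).filter fun τ => VisitsSAS (x τ) s a s').card

/-- `t(s)`: the first epoch in which `s` is visited, `⊤` if there is none. -/
def firstEpoch (x : ℕ → Traj S A H) (s : S) : ℕ∞ :=
  ⨅ τ ∈ {τ : ℕ | 1 ≤ τ ∧ Visits (x τ) s}, (τ : ℕ∞)

/-- `t(s, s') = max {t(s), t(s')}`. -/
def firstEpochPair (x : ℕ → Traj S A H) (s s' : S) : ℕ∞ :=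
  max (firstEpoch x s) (firstEpoch x s')

/-- The first time step, counted through all horizons of all epochs, at which `s` is visited,
`⊤` if there is none. -/
def arrival (x : ℕ → Traj S A H) (s : S) : ℕ∞ :=
  ⨅ p ∈ {p : ℕ × Fin H | 1 ≤ p.1 ∧ (x p.1 p.2).1 = s}, ((p.1 * H + (p.2 : ℕ) : ℕ) : ℕ∞)

open Classical in
/-- `i(s)`: the index (starting with `1`) of `s` when states are sorted by arrival. -/
def arrivalIndex [Fintype S] (x : ℕ → Traj S A H) (s : S) : ℕ :=
  (Finset.univ.filter fun r => arrival x r ≤ arrival x s).card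

open Classical in
/-- `S^Π_t`: the states visited before epoch `t`. -/
def visitedBefore [Fintype S] (x : ℕ → Traj S A H) (t : ℕ) : Finset S :=
  Finset.univ.filter fun s => ∃ τ, 1 ≤ τ ∧ τ < t ∧ Visits (x τ) s

open Classical in
/-- The non-auxiliary states of the pruned space that `SF-RL`, run with confidence `δ` and
pessimism level `ε`, maintains after `n` epochs. -/
def sfrlStates [Fintype S] (δ ε : ℝ) (x : ℕ → Traj S A H) : ℕ → Finset S
  | 0 => ∅
  | n + 1 =>
    let B := sfrlStates δ ε x n
    let t : ℕ := n + 1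
    if ∃ s, Visits (x t) s ∧ s ∉ B ∧
        (countS x t s : ℝ) / 2 - Real.log (2 * (H : ℝ) ^ 2 * (t : ℝ) ^ 2 / δ) / 2 - 1 / 2 > ε * t
    then B ∪ Finset.univ.filter fun s =>
        (countS x t s : ℝ) / 2 - Real.log (2 * (H : ℝ) ^ 2 * (t : ℝ) ^ 2 / δ) / 2 - 1 > ε * t
    else B

/-- The non-auxiliary states of `S^⊥_t`, the pruned space at the beginning of epoch `t`. -/
def sfrlStatesAt [Fintype S] (δ ε : ℝ) (x : ℕ → Traj S A H) (t : ℕ) : Finset S :=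
  sfrlStates δ ε x (t - 1)

end Path

section Pruned

/-- The pruned space: the states of `B` together with one auxiliary state `s_h^⊥` per horizon. -/
abbrev Pruned {S : Type*} (B : Finset S) (H : ℕ) := {s // s ∈ B} ⊕ Fin H

variable {S A : Type*} [Fintype S] {H : ℕ}

/-- Horizon of a state of the pruned space. -/
def LayeredMDP.prunedLayer (M : LayeredMDP S A H) (B : Finset S) : Pruned B H → Fin H
  | .inl s => M.layer s.1
  | .inr h => h

open Classical in
/-- The true transition function `P^⊥` on the pruned space. -/
def LayeredMDP.prunedP (M : LayeredMDP S A H) (B : Finset S) : Pruned B H → A → Pruned B H → ℝ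
  | .inl s, a, .inl s' => M.P s.1 a s'.1
  | .inl s, a, .inr h' =>
      if (h' : ℕ) = M.layer s.1 + 1 then
        1 - ∑ r ∈ B.filter (fun r => (M.layer r : ℕ) = M.layer s.1 + 1), M.P s.1 a r
      else 0
  | .inr _, _, .inl _ => 0
  | .inr h, _, .inr h' => if (h' : ℕ) = h + 1 then 1 else 0

/-- `Q` is a transition function of a layered MDP on the pruned space. -/
structure LayeredMDP.IsPrunedTransition (M : LayeredMDP S A H) (B : Finset S)
    (Q : Pruned B H → A → Pruned B H → ℝ) : Prop where
  nonneg : ∀ z a z', 0 ≤ Q z a z'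
  layered : ∀ z a z', Q z a z' ≠ 0 → (M.prunedLayer B z' : ℕ) = M.prunedLayer B z + 1
  sum_eq_one : ∀ z a, (M.prunedLayer B z : ℕ) + 1 < H → ∑ z', Q z a z' = 1

end Pruned

section Confidence

variable {S A : Type*} {H : ℕ}

/-- The two conventions for the visit counts with index `t`: they include the epochs strictly
before `t`, or the epochs up to and including `t`. -/
inductive CountConvention
  | before
  | through

/-- The last epoch that is counted at index `t`. -/
def CountConvention.last : CountConvention → ℕ → ℕ
  | .before, t => t - 1
  | .through, t => t

/-- `N_t(s, a)`. -/
def visitN (c : CountConvention) (x : ℕ → Traj S A H) (t : ℕ) (s : S) (a : A) : ℝ :=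
  countSA x (c.last t) s a

/-- `M_t(s' | s, a)`. -/
def visitM (c : CountConvention) (x : ℕ → Traj S A H) (t : ℕ) (s : S) (a : A) (s' : S) : ℝ :=
  countSAS x (c.last t) s a s'

/-- The partial empirical transition function `P̄_t^{t'}(s' | s, a)`. -/
def partialEmp (c : CountConvention) (x : ℕ → Traj S A H) (t t' : ℕ) (s : S) (a : A) (s' : S) :
    ℝ :=
  (visitM c x t s a s' - visitM c x t' s a s') / max 1 (visitN c x t s a - visitN c x t' s a)

/-- The width `ε_t^1(s' | s, a)`, where `d` is the confidence level `δ(s, a, s')`. -/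
def width1 (c : CountConvention) (x : ℕ → Traj S A H) (d : ℝ) (t : ℕ) (s : S) (a : A) (s' : S) :
    ℝ :=
  let t' := (firstEpochPair x s s').toNat
  let n := max (visitN c x t s a - visitN c x t' s a - 1) 1
  4 * Real.sqrt (partialEmp c x t t' s a s' * Real.log (t / d) / n) + 20 * Real.log (t / d) / n

/-- The width `ε_t^2(s' | s, a)`, where `d` is the confidence level `δ(s, a)`. -/
def width2 [Fintype S] (c : CountConvention) (x : ℕ → Traj S A H) (d : ℝ) (t : ℕ) (s : S) (a : A)
    (s' : S) : ℝ :=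
  let t' := (firstEpoch x s').toNat
  (2 * ((visitedBefore x t').card : ℝ) + 24 * Real.log (t / d)) / max (visitN c x t' s a - 1) 1

/-- The interval `I_t^1(s' | s, a)`. -/
def interval1 (c : CountConvention) (x : ℕ → Traj S A H) (d : ℝ) (t : ℕ) (s : S) (a : A)
    (s' : S) : Set ℝ :=
  let p := partialEmp c x t (firstEpochPair x s s').toNat s a s'
  Set.Icc (p - width1 c x d t s a s') (p + width1 c x d t s a s')

open Classical in
/-- The interval `I_t^2(s' | s, a)`. -/
def interval2 [Fintype S] (c : CountConvention) (x : ℕ → Traj S A H) (d : ℝ) (t : ℕ) (s : S)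
    (a : A) (s' : S) : Set ℝ :=
  if firstEpoch x s + 1 ≤ firstEpoch x s' then Set.Icc 0 (width2 c x d t s a s')
  else Set.Icc 0 1

/-- The confidence set for the transition function on the pruned space with non-auxiliary states
`B`, built at index `t` with confidence levels `d₁ s a s' = δ(s, a, s')` and
`d₂ s a = δ(s, a)`. -/
def LayeredMDP.confSet [Fintype S] (M : LayeredMDP S A H) (c : CountConvention)
    (x : ℕ → Traj S A H) (d₁ : S → A → S → ℝ) (d₂ : S → A → ℝ) (t : ℕ) (B : Finset S) :
    Set (Pruned B H → A → Pruned B H → ℝ) :=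
  {Q | M.IsPrunedTransition B Q ∧
    (∀ (s : {s // s ∈ B}) (a : A) (s' : {s // s ∈ B}), (M.layer s'.1 : ℕ) = M.layer s.1 + 1 →
      Q (.inl s) a (.inl s') ∈
        interval1 c x (d₁ s.1 a s'.1) t s.1 a s'.1 ∩ interval2 c x (d₂ s.1 a) t s.1 a s'.1) ∧
    (∀ (h : Fin H) (a : A) (z' : Pruned B H), (M.prunedLayer B z' : ℕ) = h + 1 →
      (z'.isRight = true → Q (.inr h) a z' = 1) ∧ (z'.isLeft = true → Q (.inr h) a z' = 0))}

/-- `δ(s, a, s') = δ / (4 (i(s)^4 + i(s')^4) |A|)`. -/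
def levelSAS [Fintype S] [Fintype A] (δ : ℝ) (x : ℕ → Traj S A H) (s : S) (_a : A) (s' : S) : ℝ :=
  δ / (4 * ((arrivalIndex x s : ℝ) ^ 4 + (arrivalIndex x s' : ℝ) ^ 4) * Fintype.card A)

/-- `δ(s, a) = δ / (4 i(s)^2 |A|)`. -/
def levelSA [Fintype S] [Fintype A] (δ : ℝ) (x : ℕ → Traj S A H) (s : S) (_a : A) : ℝ :=
  δ / (4 * (arrivalIndex x s : ℝ) ^ 2 * Fintype.card A)

end Confidence

end StateFreeRL

end

/-! The failure probability must not grow with the number of states, so a union bound over states by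
name is not available. It runs over arrival indices `i`, `j` instead, with weights `1/i²`, `1/j²`
whose sums are at most 2. The state behind an index is random. Once visited, however, its index is
fixed by the past (`arrivalIndex_congr`) and shared with no other visited state
(`arrivalIndex_injOn`). Counting only the epochs after that visit keeps the exponential process that
follows "the state with index `i`" a supermartingale (`IsInteraction.measureReal_selected_le`).

Two exponential inequalities are fed into this. For `interval1`: at a visit of `(s, a)`, the
indicator of moving to `s'`, which has mean `p`, satisfies `E exp(l·1 - (l + l²) p) ≤ 1` for `|l| ≤
1`. Tuning `l` to every possible number `ν` of visits gives `|m - pν| ≤ 4√(Lm) + 12L`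
(`abs_sub_le_of_tilted`) for the counts `m`, `ν` after both states are known. The counts in the
definition of the interval exceed these by at most one visit, and the constants absorb it
(`abs_sub_div_le`).

For `interval2`: before its first visit `s'` is undiscovered, so `P(s'|s,a)` is at most the
probability `U` of moving to an undiscovered state. Since `E exp(U/2 - 1{discovery}) ≤ 1`, the
accumulated `U/2` is at most the number of discoveries made from `(s, a)` plus a logarithm. Distinct
discovery epochs yield distinct states, so this number is at most the size of the visited set
(`mem_interval2`).

The two bad events have probability at most `δ/4` and `δ/2`. Outside them both intervals hold for
all pairs of visited states in consecutive layers, hence for every pruned space of visited states.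
SF-RL is a special case because it only ever adds visited states (`sfrlStates_subset`). -/

namespace StateFreeRL

/-! ### Arrival times and arrival indices along a fixed sequence of trajectories. -/

section PathFacts

variable {S A : Type*} {H : ℕ}

theorem VisitsSA.visits {o : Traj S A H} {s : S} {a : A} (h : VisitsSA o s a) : Visits o s := by
  obtain ⟨k, hk⟩ := h
  exact ⟨k, by rw [hk]⟩

theorem VisitsSAS.visitsSA {o : Traj S A H} {s : S} {a : A} {s' : S} (h : VisitsSAS o s a s') :
    VisitsSA o s a := by
  obtain ⟨k, _, _, hk, _⟩ := h
  exact ⟨k, hk⟩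

theorem VisitsSAS.visits_right {o : Traj S A H} {s : S} {a : A} {s' : S}
    (h : VisitsSAS o s a s') : Visits o s' := by
  obtain ⟨_, k, _, _, hk⟩ := h
  exact ⟨k, hk⟩

theorem arrival_le_iff {x : ℕ → Traj S A H} {s : S} {m : ℕ} :
    arrival x s ≤ m ↔ ∃ p : ℕ × Fin H, 1 ≤ p.1 ∧ (x p.1 p.2).1 = s ∧ p.1 * H + p.2 ≤ m := by
  constructor
  · intro h
    by_contra! hc
    have : ((m + 1 : ℕ) : ℕ∞) ≤ arrival x s := by
      refine le_iInf₂ fun p hp => ?_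
      exact_mod_cast hc p hp.1 hp.2
    have := this.trans h
    norm_cast at this
    omega
  · rintro ⟨p, h1, h2, h3⟩
    exact (iInf₂_le p ⟨h1, h2⟩).trans (by exact_mod_cast h3)

theorem arrival_le_iff_of_agree {x y : ℕ → Traj S A H} {t : ℕ}
    (hxy : ∀ k, 1 ≤ k → k < t → x k = y k) {s : S} {m : ℕ} (hm : m < t * H) :
    arrival x s ≤ m ↔ arrival y s ≤ m := by
  have key : ∀ p : ℕ × Fin H, p.1 * H + p.2 ≤ m → p.1 < t := by
    intro p hp
    by_contra! hc
    have := Nat.mul_le_mul_right H hc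
    omega
  rw [arrival_le_iff, arrival_le_iff]
  constructor
  · rintro ⟨p, h1, h2, h3⟩
    exact ⟨p, h1, by rw [← hxy _ h1 (key p h3)]; exact h2, h3⟩
  · rintro ⟨p, h1, h2, h3⟩
    exact ⟨p, h1, by rw [hxy _ h1 (key p h3)]; exact h2, h3⟩

/-- Division by `H` recovers epoch and horizon from an arrival time, and a single state occupies
that position. -/
theorem eq_of_arrival_eq {x : ℕ → Traj S A H} {s r : S} {m : ℕ} (hs : arrival x s = m)
    (hr : arrival x r = m) : s = r := by
  have aux : ∀ {s : S}, arrival x s = m →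
      ∃ p : ℕ × Fin H, (x p.1 p.2).1 = s ∧ p.1 * H + p.2 = m := by
    intro s hs
    obtain ⟨p, h1, h2, h3⟩ := arrival_le_iff.1 hs.le
    refine ⟨p, h2, le_antisymm h3 ?_⟩
    have : arrival x s ≤ ((p.1 * H + p.2 : ℕ) : ℕ∞) := arrival_le_iff.2 ⟨p, h1, h2, le_rfl⟩
    rw [hs] at this
    exact_mod_cast this
  obtain ⟨p, hp, hpm⟩ := aux hs
  obtain ⟨q, hq, hqm⟩ := aux hr
  have hH : 0 < H := p.2.pos
  have e1 : p.1 = q.1 := by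
    have h1 : (p.1 * H + p.2) / H = p.1 := by
      rw [mul_comm, Nat.mul_add_div hH, Nat.div_eq_of_lt p.2.2, add_zero]
    have h2 : (q.1 * H + q.2) / H = q.1 := by
      rw [mul_comm, Nat.mul_add_div hH, Nat.div_eq_of_lt q.2.2, add_zero]
    rw [← h1, ← h2, hpm, hqm]
  have e2 : p.2 = q.2 := by
    ext
    rw [e1] at hpm
    omega
  rw [← hp, ← hq, e1, e2]

variable [Fintype S]

theorem mem_visitedBefore {x : ℕ → Traj S A H} {t : ℕ} {s : S} :
    s ∈ visitedBefore x t ↔ ∃ τ, 1 ≤ τ ∧ τ < t ∧ Visits (x τ) s := by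
  simp [visitedBefore]

/-- The first epoch of a visited state, as a natural number. -/
theorem exists_firstEpoch_eq {x : ℕ → Traj S A H} {t : ℕ} {s : S} (hs : s ∈ visitedBefore x t) :
    ∃ τ : ℕ, firstEpoch x s = τ ∧ 1 ≤ τ ∧ τ < t ∧ Visits (x τ) s ∧
      ∀ k, s ∈ visitedBefore x k ↔ τ < k := by
  classical
  rw [mem_visitedBefore] at hs
  have hex : ∃ τ, 1 ≤ τ ∧ Visits (x τ) s := by
    obtain ⟨τ, h1, _, h3⟩ := hs
    exact ⟨τ, h1, h3⟩
  refine ⟨Nat.find hex, ?_, (Nat.find_spec hex).1, ?_, (Nat.find_spec hex).2, ?_⟩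
  · refine le_antisymm (iInf₂_le (f := fun (τ : ℕ) (_ : 1 ≤ τ ∧ Visits (x τ) s) => (τ : ℕ∞))
      (Nat.find hex) (Nat.find_spec hex)) (le_iInf₂ fun τ hτ => ?_)
    exact_mod_cast Nat.find_min' hex hτ
  · obtain ⟨τ, h1, h2, h3⟩ := hs
    exact (Nat.find_min' hex ⟨h1, h3⟩).trans_lt h2
  · intro k
    rw [mem_visitedBefore]
    constructor
    · rintro ⟨τ, h1, h2, h3⟩
      exact (Nat.find_min' hex ⟨h1, h3⟩).trans_lt h2
    · intro h
      exact ⟨_, (Nat.find_spec hex).1, h, (Nat.find_spec hex).2⟩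

/-- The arrival of a visited state, as a natural number. -/
theorem exists_arrival_eq {x : ℕ → Traj S A H} {t : ℕ} {s : S} (hs : s ∈ visitedBefore x t) :
    ∃ m : ℕ, arrival x s = m ∧ m < t * H := by
  obtain ⟨τ, h1, h2, h, h3⟩ := mem_visitedBefore.1 hs
  have hle : arrival x s ≤ ((τ * H + h : ℕ) : ℕ∞) := arrival_le_iff.2 ⟨(τ, h), h1, h3, le_rfl⟩
  obtain ⟨m, hm⟩ := ENat.ne_top_iff_exists.1 (ne_top_of_le_ne_top (ENat.natCast_ne_top _) hle)
  refine ⟨m, hm.symm, ?_⟩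
  rw [← hm] at hle
  have hle' : m ≤ τ * H + h := by exact_mod_cast hle
  have : (τ + 1) * H ≤ t * H := Nat.mul_le_mul_right _ h2
  have := h.2
  nlinarith

theorem visitedBefore_congr {x y : ℕ → Traj S A H} {t : ℕ}
    (hxy : ∀ k, 1 ≤ k → k < t → x k = y k) : visitedBefore x t = visitedBefore y t := by
  ext s
  simp only [mem_visitedBefore]
  refine exists_congr fun τ => ⟨?_, ?_⟩
  · rintro ⟨h1, h2, h3⟩
    exact ⟨h1, h2, hxy τ h1 h2 ▸ h3⟩
  · rintro ⟨h1, h2, h3⟩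
    exact ⟨h1, h2, hxy τ h1 h2 ▸ h3⟩

/-- Every state that arrives no later than `s` has also arrived before epoch `t`, so the rank of `s`
is already settled. This makes the index a label that is determined by the past. -/
theorem arrivalIndex_congr {x y : ℕ → Traj S A H} {t : ℕ}
    (hxy : ∀ k, 1 ≤ k → k < t → x k = y k) {s : S} (hs : s ∈ visitedBefore x t) :
    arrivalIndex x s = arrivalIndex y s := by
  obtain ⟨m, hm, hmt⟩ := exists_arrival_eq hs
  have hsy : arrival y s = m := by
    refine le_antisymm ((arrival_le_iff_of_agree hxy hmt).1 hm.le) ?_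
    by_contra! hc
    obtain ⟨m', hm'⟩ := ENat.ne_top_iff_exists.1 (ne_top_of_lt hc)
    rw [← hm'] at hc
    have hc' : m' < m := by exact_mod_cast hc
    have := (arrival_le_iff_of_agree hxy (hc'.trans hmt)).2 hm'.symm.le
    rw [hm] at this
    have : m ≤ m' := by exact_mod_cast this
    omega
  unfold arrivalIndex
  congr 1
  ext r
  simp only [Finset.mem_filter, Finset.mem_univ, true_and, hm, hsy]
  exact arrival_le_iff_of_agree hxy hmt

theorem one_le_arrivalIndex (x : ℕ → Traj S A H) (s : S) : 1 ≤ arrivalIndex x s := by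
  refine Finset.card_pos.2 ⟨s, ?_⟩
  simp

theorem arrivalIndex_le_card (x : ℕ → Traj S A H) (s : S) :
    arrivalIndex x s ≤ Fintype.card S := Finset.card_le_univ _

/-- The sets of earlier arrivals are nested, so equal cardinality forces equal arrival times. The
restriction to visited states matters: all unvisited states have arrival `⊤` and share the index
`|S|`. -/
theorem arrivalIndex_injOn (x : ℕ → Traj S A H) (t : ℕ) :
    Set.InjOn (arrivalIndex x) (visitedBefore x t) := by
  classical
  have aux : ∀ {s r : S}, s ∈ visitedBefore x t → r ∈ visitedBefore x t →
      arrival x s ≤ arrival x r → arrivalIndex x s = arrivalIndex x r → s = r := by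
    intro s r hs hr hle hi
    have hsub : (Finset.univ.filter fun q => arrival x q ≤ arrival x s) ⊆
        Finset.univ.filter fun q => arrival x q ≤ arrival x r := by
      intro q hq
      simp only [Finset.mem_filter, Finset.mem_univ, true_and] at hq ⊢
      exact hq.trans hle
    have heq := Finset.eq_of_subset_of_card_le hsub (by
      have := hi.symm.le
      unfold arrivalIndex at this
      convert this)
    have hr' : r ∈ Finset.univ.filter fun q => arrival x q ≤ arrival x s := by
      rw [heq]; simp
    simp only [Finset.mem_filter, Finset.mem_univ, true_and] at hr'
    obtain ⟨m, hm, _⟩ := exists_arrival_eq hs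
    exact eq_of_arrival_eq hm ((le_antisymm hle hr') ▸ hm)
  intro s hs r hr hi
  rcases le_total (arrival x s) (arrival x r) with h | h
  · exact aux hs hr h hi
  · exact (aux hr hs h hi.symm).symm

theorem countS_pos {x : ℕ → Traj S A H} {n : ℕ} {s : S} (h : 0 < countS x n s) :
    s ∈ visitedBefore x (n + 1) := by
  obtain ⟨τ, hτ⟩ := Finset.card_pos.1 h
  simp only [Finset.mem_filter, Finset.mem_Icc] at hτ
  exact mem_visitedBefore.2 ⟨τ, hτ.1.1, by omega, hτ.2⟩

theorem visitedBefore_mono (x : ℕ → Traj S A H) : Monotone (visitedBefore x) := by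
  intro t t' htt' s hs
  obtain ⟨τ, h1, h2, h3⟩ := mem_visitedBefore.1 hs
  exact mem_visitedBefore.2 ⟨τ, h1, h2.trans_le htt', h3⟩

/-- The logarithm and `ε * t` are nonnegative, so passing the threshold forces a positive visit
count. -/
theorem sfrlStates_subset (hH : 1 ≤ H) {δ ε : ℝ} (hδ : 0 < δ) (hδ1 : δ < 1) (hε : 0 ≤ ε)
    (x : ℕ → Traj S A H) (n : ℕ) : sfrlStates δ ε x n ⊆ visitedBefore x (n + 1) := by
  classical
  induction n with
  | zero => simp [sfrlStates]
  | succ n ih =>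
    have ih' := ih.trans (visitedBefore_mono x (Nat.le_succ (n + 1)))
    rw [sfrlStates]
    split_ifs
    · refine Finset.union_subset ih' fun s hs => ?_
      simp only [Finset.mem_filter, Finset.mem_univ, true_and] at hs
      refine countS_pos ?_
      have hlog : 0 ≤ Real.log (2 * (H : ℝ) ^ 2 * ((n + 1 : ℕ) : ℝ) ^ 2 / δ) := by
        refine Real.log_nonneg ?_
        rw [le_div_iff₀ hδ]
        have h1 : (1 : ℝ) ≤ (H : ℝ) ^ 2 := one_le_pow₀ (by exact_mod_cast hH)
        have h2 : (1 : ℝ) ≤ ((n + 1 : ℕ) : ℝ) ^ 2 :=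
          one_le_pow₀ (by exact_mod_cast Nat.le_add_left 1 n)
        nlinarith
      have hεt : 0 ≤ ε * ((n + 1 : ℕ) : ℝ) := by positivity
      have : (0 : ℝ) < countS x (n + 1) s := by linarith
      exact_mod_cast this
    · exact ih'

end PathFacts

/-! ### Trajectory law and Markov property. -/

section Marginals

variable {S A : Type*} [Fintype S] {H : ℕ}

theorem LayeredMDP.P_le_one (M : LayeredMDP S A H) (s : S) (a : A) (s' : S) : M.P s a s' ≤ 1 := by
  by_cases h : M.P s a s' = 0
  · rw [h]; exact zero_le_one
  · have hl := M.P_layer s a s' h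
    rw [← M.P_sum s a (by have := (M.layer s').2; omega)]
    exact Finset.single_le_sum (fun r _ => M.P_nonneg s a r) (Finset.mem_univ s')

theorem LayeredMDP.nonempty_state (M : LayeredMDP S A H) : Nonempty S := by
  by_contra h
  rw [not_nonempty_iff] at h
  have := M.init_sum
  simp at this

theorem LayeredMDP.horizon_pos (M : LayeredMDP S A H) : 1 ≤ H :=
  (M.layer M.nonempty_state.some).pos

/-- Law of the state at horizon `k`, given the earlier part of the trajectory. -/
def LayeredMDP.nextLaw (M : LayeredMDP S A H) (o : Traj S A H) (k : Fin H) (s : S) : ℝ :=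
  if (k : ℕ) = 0 then M.init s
  else M.P (o ⟨k - 1, by omega⟩).1 (o ⟨k - 1, by omega⟩).2 s

/-- Probability of the first `k` steps of a trajectory. -/
def LayeredMDP.prefixProb (M : LayeredMDP S A H) (π : S → A → ℝ) (k : ℕ) (o : Traj S A H) : ℝ :=
  ∏ h ∈ Finset.univ.filter (fun h : Fin H => (h : ℕ) < k), M.nextLaw o h (o h).1 * π (o h).1 (o h).2

theorem LayeredMDP.prefixProb_horizon (M : LayeredMDP S A H) (π : S → A → ℝ) (o : Traj S A H) :
    M.prefixProb π H o = M.trajProb π o := by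
  unfold prefixProb trajProb
  rw [Finset.filter_true_of_mem (fun h _ => h.2)]
  rfl

theorem LayeredMDP.prefixProb_zero (M : LayeredMDP S A H) (π : S → A → ℝ) (o : Traj S A H) :
    M.prefixProb π 0 o = 1 := by
  simp [prefixProb]

theorem LayeredMDP.nextLaw_update (M : LayeredMDP S A H) (o : Traj S A H) {h k : Fin H}
    (hk : h ≤ k) (z : S × A) : M.nextLaw (Function.update o k z) h = M.nextLaw o h := by
  ext s
  unfold nextLaw
  split_ifs with h0
  · rfl
  · have hne : (⟨h - 1, by omega⟩ : Fin H) ≠ k := by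
      intro he
      have := congrArg Fin.val he
      have hk' : (h : ℕ) ≤ k := hk
      simp only at this
      omega
    rw [Function.update_of_ne hne]

theorem LayeredMDP.prefixProb_succ_update (M : LayeredMDP S A H) (π : S → A → ℝ)
    (o : Traj S A H) (k : Fin H) (z : S × A) :
    M.prefixProb π (k + 1) (Function.update o k z) =
      M.prefixProb π k o * (M.nextLaw o k z.1 * π z.1 z.2) := by
  unfold prefixProb
  have hset : (Finset.univ.filter fun h : Fin H => (h : ℕ) < k + 1) =
      insert k (Finset.univ.filter fun h : Fin H => (h : ℕ) < k) := by
    ext h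
    simp only [Finset.mem_filter, Finset.mem_univ, true_and, Finset.mem_insert, Fin.ext_iff]
    omega
  rw [hset, Finset.prod_insert (by simp), mul_comm, M.nextLaw_update o le_rfl]
  simp only [Function.update_self]
  congr 1
  refine Finset.prod_congr rfl fun h hh => ?_
  simp only [Finset.mem_filter, Finset.mem_univ, true_and] at hh
  have hne : h ≠ k := by
    rintro rfl
    exact lt_irrefl _ hh
  rw [M.nextLaw_update o (Fin.le_iff_val_le_val.2 hh.le), Function.update_of_ne hne]

theorem LayeredMDP.layer_eq_of_prefixProb_ne_zero (M : LayeredMDP S A H) {π : S → A → ℝ} {k : ℕ}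
    {o : Traj S A H} (ho : M.prefixProb π k o ≠ 0) (h : Fin H) (hk : (h : ℕ) < k) :
    M.layer (o h).1 = h := by
  have hf : ∀ h : Fin H, (h : ℕ) < k → M.nextLaw o h (o h).1 ≠ 0 := by
    intro h hh hz
    refine ho (Finset.prod_eq_zero (i := h) (by simpa using hh) ?_)
    rw [hz, zero_mul]
  obtain ⟨n, hn⟩ := h
  induction n with
  | zero =>
    have := hf ⟨0, hn⟩ hk
    unfold nextLaw at this
    rw [if_pos rfl] at this
    exact Fin.ext (M.init_layer _ this)
  | succ n ih =>
    have := hf ⟨n + 1, hn⟩ hk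
    unfold nextLaw at this
    rw [if_neg (Nat.succ_ne_zero n)] at this
    have h1 := M.P_layer _ _ _ this
    have h2 := ih (by omega) (by simp only at hk ⊢; omega)
    refine Fin.ext ?_
    rw [h1]
    exact congrArg (fun i : Fin H => (i : ℕ) + 1) h2

/-- The states of the trajectory are in the right layers. -/
def LayeredMDP.Layered (M : LayeredMDP S A H) (o : Traj S A H) : Prop :=
  ∀ h, M.layer (o h).1 = h

theorem LayeredMDP.layered_of_trajProb_ne_zero (M : LayeredMDP S A H) {π : S → A → ℝ}
    {o : Traj S A H} (ho : M.trajProb π o ≠ 0) : M.Layered o := by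
  rw [← M.prefixProb_horizon] at ho
  exact fun h => M.layer_eq_of_prefixProb_ne_zero ho h h.2

theorem LayeredMDP.sum_nextLaw_of_prefixProb_ne_zero (M : LayeredMDP S A H) {π : S → A → ℝ}
    {k : Fin H} {o : Traj S A H} (ho : M.prefixProb π k o ≠ 0) : ∑ s, M.nextLaw o k s = 1 := by
  unfold nextLaw
  split_ifs with h0
  · exact M.init_sum
  · refine M.P_sum _ _ ?_
    rw [M.layer_eq_of_prefixProb_ne_zero ho _ (by simp only; omega)]
    have := k.2
    simp only
    omega

theorem LayeredMDP.Layered.visitsSA_iff {M : LayeredMDP S A H} {o : Traj S A H} (ho : M.Layered o)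
    {s : S} {a : A} : VisitsSA o s a ↔ o (M.layer s) = (s, a) := by
  constructor
  · rintro ⟨h, hh⟩
    have := ho h
    rw [hh] at this
    rw [this, hh]
  · exact fun h => ⟨_, h⟩

theorem LayeredMDP.Layered.visitsSAS_iff {M : LayeredMDP S A H} {o : Traj S A H}
    (ho : M.Layered o) {s : S} {a : A} {s' : S} (hs : (M.layer s : ℕ) + 1 < H) :
    VisitsSAS o s a s' ↔ o (M.layer s) = (s, a) ∧ (o ⟨M.layer s + 1, hs⟩).1 = s' := by
  constructor
  · rintro ⟨h, h', hh', hh, hs'⟩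
    have := ho h
    rw [hh] at this
    refine ⟨by rw [this, hh], ?_⟩
    rw [← hs']
    congr 3
    rw [this, hh']
  · exact fun h => ⟨_, _, rfl, h.1, h.2⟩

variable [Fintype A]

/-- Exchanging coordinate `k` with the extra variable, `(o, z) ↦ (update o k z, o k)`, is an
involution. This allows one coordinate to be summed out while all sums stay over full trajectories.
-/
theorem sum_sum_update (k : Fin H) (φ : Traj S A H → ℝ) :
    ∑ o, ∑ z, φ (Function.update o k z) = Fintype.card (S × A) * ∑ o, φ o := by
  classical
  have hinv : Function.Involutive
      (fun p : Traj S A H × (S × A) => (Function.update p.1 k p.2, p.1 k)) := by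
    rintro ⟨o, z⟩
    simp
  rw [← Fintype.sum_prod_type' (f := fun o z => φ (Function.update o k z))]
  have h := Fintype.sum_equiv hinv.toPerm (fun p => φ (Function.update p.1 k p.2))
    (fun p => φ p.1) (fun p => rfl)
  rw [h, Fintype.sum_prod_type]
  simp [Finset.mul_sum]

theorem LayeredMDP.sum_prefixProb_succ (M : LayeredMDP S A H) {π : S → A → ℝ}
    (hπ : ∀ s, π s ∈ stdSimplex ℝ A) (k : Fin H) {f : Traj S A H → ℝ}
    (hf : ∀ o z, f (Function.update o k z) = f o) (g : S → ℝ) :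
    Fintype.card (S × A) * ∑ o, M.prefixProb π (k + 1) o * f o * g (o k).1 =
      ∑ o, M.prefixProb π k o * f o * ∑ s, M.nextLaw o k s * g s := by
  rw [← sum_sum_update k]
  refine Finset.sum_congr rfl fun o _ => ?_
  simp only [M.prefixProb_succ_update, hf, Function.update_self]
  rw [Fintype.sum_prod_type, Finset.mul_sum]
  refine Finset.sum_congr rfl fun s _ => ?_
  have : ∀ a, M.prefixProb π k o * (M.nextLaw o k s * π s a) * f o * g s =
      M.prefixProb π k o * f o * (M.nextLaw o k s * g s) * π s a := fun a => by ring
  simp only [this]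
  rw [← Finset.mul_sum, (hπ s).2, mul_one]

/-- Integrates out the last `d` steps. The power of `card (S × A)` appears because the right side
still sums over those coordinates, on which neither factor depends. -/
theorem LayeredMDP.sum_prefixProb (M : LayeredMDP S A H) {π : S → A → ℝ}
    (hπ : ∀ s, π s ∈ stdSimplex ℝ A) {f : Traj S A H → ℝ} (d : ℕ) :
    ∀ k, k + d = H → (∀ h : Fin H, k ≤ h → ∀ o z, f (Function.update o h z) = f o) →
    (Fintype.card (S × A) : ℝ) ^ d * ∑ o, M.trajProb π o * f o =
      ∑ o, M.prefixProb π k o * f o := by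
  induction d with
  | zero =>
    intro k hk _
    obtain rfl : k = H := hk
    simp [M.prefixProb_horizon]
  | succ d ih =>
    intro k hk hf
    have hkH : k < H := by omega
    rw [pow_succ', mul_assoc, ih (k + 1) (by omega) (fun h hh => hf h (by omega))]
    have := M.sum_prefixProb_succ hπ ⟨k, hkH⟩ (hf ⟨k, hkH⟩ le_rfl) (fun _ => 1)
    simp only [mul_one] at this
    rw [this]
    refine Finset.sum_congr rfl fun o _ => ?_
    -- A row of `P` is known to sum to one only at a state before the last layer, and layers are
    -- under control only on prefixes of positive probability.
    by_cases ho : M.prefixProb π k o = 0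
    · rw [ho]; ring
    · rw [M.sum_nextLaw_of_prefixProb_ne_zero (k := ⟨k, hkH⟩) ho, mul_one]

theorem LayeredMDP.trajProb_nonneg (M : LayeredMDP S A H) {π : S → A → ℝ}
    (hπ : ∀ s, π s ∈ stdSimplex ℝ A) (o : Traj S A H) : 0 ≤ M.trajProb π o := by
  refine Finset.prod_nonneg fun h _ => mul_nonneg ?_ ((hπ _).1 _)
  split_ifs
  · exact M.init_nonneg _
  · exact M.P_nonneg _ _ _

theorem card_stateAction_ne_zero (M : LayeredMDP S A H) {π : S → A → ℝ}
    (hπ : ∀ s, π s ∈ stdSimplex ℝ A) : (Fintype.card (S × A) : ℝ) ≠ 0 := by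
  have hA : Nonempty A := by
    by_contra h
    rw [not_nonempty_iff] at h
    have := (hπ M.nonempty_state.some).2
    simp at this
  have := M.nonempty_state
  exact_mod_cast Fintype.card_ne_zero

theorem LayeredMDP.sum_trajProb (M : LayeredMDP S A H) {π : S → A → ℝ}
    (hπ : ∀ s, π s ∈ stdSimplex ℝ A) : ∑ o, M.trajProb π o = 1 := by
  have h := M.sum_prefixProb hπ (f := fun _ => 1) H 0 (zero_add H) (fun _ _ _ _ => rfl)
  simp only [mul_one, M.prefixProb_zero] at h
  have hc := card_stateAction_ne_zero M hπ
  have : ∑ _o : Traj S A H, (1 : ℝ) = (Fintype.card (S × A) : ℝ) ^ H := by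
    simp
  rw [this] at h
  exact mul_left_cancel₀ (pow_ne_zero H hc) (h.trans (mul_one _).symm)

open Classical in
/-- Markov property: after a visit of `(s, a)`, the next state has law `P(· | s, a)`. -/
theorem LayeredMDP.sum_trajProb_next (M : LayeredMDP S A H) {π : S → A → ℝ}
    (hπ : ∀ s, π s ∈ stdSimplex ℝ A) (s : S) (a : A) (hs : (M.layer s : ℕ) + 1 < H) (g : S → ℝ) :
    ∑ o, M.trajProb π o *
        ((if o (M.layer s) = (s, a) then 1 else 0) * g (o ⟨M.layer s + 1, hs⟩).1) =
      (∑ o, M.trajProb π o * (if o (M.layer s) = (s, a) then 1 else 0)) *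
        ∑ s', M.P s a s' * g s' := by
  set f : Traj S A H → ℝ := fun o => if o (M.layer s) = (s, a) then 1 else 0 with hfdef
  have hf : ∀ h : Fin H, (M.layer s : ℕ) + 1 ≤ h → ∀ o z, f (Function.update o h z) = f o := by
    intro h hh o z
    have : M.layer s ≠ h := by
      intro he
      rw [← he] at hh
      omega
    simp only [hfdef, Function.update_of_ne this]
  have hc := card_stateAction_ne_zero M hπ
  obtain ⟨d, hd⟩ : ∃ d, (M.layer s : ℕ) + 1 + 1 + d = H := ⟨_, Nat.add_sub_of_le hs⟩
  have e1 := M.sum_prefixProb hπ (f := f) (d + 1) (M.layer s + 1) (by omega) hf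
  have e2 := M.sum_prefixProb hπ (f := fun o => f o * g (o ⟨M.layer s + 1, hs⟩).1) d
    (M.layer s + 1 + 1) hd (by
      intro h hh o z
      have : (⟨M.layer s + 1, hs⟩ : Fin H) ≠ h := by
        intro he
        rw [← he] at hh
        simp only at hh
        omega
      rw [hf h (by omega), Function.update_of_ne this])
  have e3 := M.sum_prefixProb_succ hπ ⟨M.layer s + 1, hs⟩ (f := f) (hf _ le_rfl) g
  have e4 : ∑ o, M.prefixProb π (M.layer s + 1) o * f o *
      ∑ s', M.nextLaw o ⟨M.layer s + 1, hs⟩ s' * g s' =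
      (∑ o, M.prefixProb π (M.layer s + 1) o * f o) * ∑ s', M.P s a s' * g s' := by
    rw [Finset.sum_mul]
    refine Finset.sum_congr rfl fun o _ => ?_
    by_cases ho : o (M.layer s) = (s, a)
    · congr 1
      refine Finset.sum_congr rfl fun s' _ => ?_
      have : (⟨(M.layer s : ℕ) + 1 - 1, by omega⟩ : Fin H) = M.layer s := by
        ext; simp
      simp only [nextLaw, Nat.succ_ne_zero, if_false, this, ho]
    · simp only [hfdef, if_neg ho]
      ring
  refine mul_left_cancel₀ (pow_ne_zero (d + 1) hc) ?_
  rw [← mul_assoc, e1, ← e4, ← e3, pow_succ', mul_assoc, e2]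
  simp only [mul_assoc]

/-- A functional of a trajectory which is `1` unless `(s, a)` is visited, and then only depends on
the next state, has mean at most `1` if its mean under `P(· | s, a)` is at most `1`. -/
theorem LayeredMDP.sum_trajProb_mul_le_one (M : LayeredMDP S A H) {π : S → A → ℝ}
    (hπ : ∀ s, π s ∈ stdSimplex ℝ A) (s : S) (a : A) (hs : (M.layer s : ℕ) + 1 < H) (g : S → ℝ)
    (hg : ∑ s', M.P s a s' * g s' ≤ 1) (φ : Traj S A H → ℝ)
    (hφ1 : ∀ o, M.Layered o → ¬ VisitsSA o s a → φ o = 1)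
    (hφ2 : ∀ o s', M.Layered o → VisitsSAS o s a s' → φ o = g s') :
    ∑ o, M.trajProb π o * φ o ≤ 1 := by
  classical
  -- Summed over `o`, this says that the mean of `φ` is `1 + q (∑ P g - 1)`, with `q` the
  -- probability of visiting `(s, a)`.
  have key : ∀ o, M.trajProb π o * φ o = M.trajProb π o + (M.trajProb π o *
        ((if o (M.layer s) = (s, a) then 1 else 0) * g (o ⟨M.layer s + 1, hs⟩).1) -
        M.trajProb π o * (if o (M.layer s) = (s, a) then 1 else 0)) := by
    intro o
    by_cases h0 : M.trajProb π o = 0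
    · rw [h0]; ring
    · have hl := M.layered_of_trajProb_ne_zero h0
      by_cases hv : o (M.layer s) = (s, a)
      · rw [hφ2 o _ hl ((hl.visitsSAS_iff hs).2 ⟨hv, rfl⟩), if_pos hv]
        ring
      · rw [hφ1 o hl (fun h => hv (hl.visitsSA_iff.1 h)), if_neg hv]
        ring
  rw [Finset.sum_congr rfl fun o _ => key o, Finset.sum_add_distrib, Finset.sum_sub_distrib,
    M.sum_trajProb hπ, M.sum_trajProb_next hπ s a hs g]
  have : 0 ≤ ∑ o, M.trajProb π o * (if o (M.layer s) = (s, a) then 1 else 0) := by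
    refine Finset.sum_nonneg fun o _ => mul_nonneg (M.trajProb_nonneg hπ o) ?_
    split_ifs <;> simp
  nlinarith

end Marginals

/-! ### Products of factors with conditional mean at most one. -/

section ProductBound

variable {S A : Type*} {H : ℕ}

/-- `Φ` depends on a sequence of trajectories only through the epochs `1, …, n`. -/
def DependsOnPast (n : ℕ) {β : Type*} (Φ : (ℕ → Traj S A H) → β) : Prop :=
  ∀ y z, (∀ k, 1 ≤ k → k ≤ n → y k = z k) → Φ y = Φ z

/-- For finite `S` and `A` the tuples form a finite type, so boundedness and measurability of
functions of the past come for free. -/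
theorem DependsOnPast.exists_factor {n : ℕ} {β : Type*} {Φ : (ℕ → Traj S A H) → β}
    (hΦ : DependsOnPast n Φ) [Nonempty (Traj S A H)] :
    ∃ Ψ : (Fin n → Traj S A H) → β, ∀ y, Φ y = Ψ fun i => y (i + 1) := by
  classical
  refine ⟨fun v => Φ fun k => if h : 1 ≤ k ∧ k ≤ n then v ⟨k - 1, by omega⟩
    else Classical.arbitrary _, fun y => hΦ _ _ fun k h1 h2 => ?_⟩
  rw [dif_pos ⟨h1, h2⟩]
  simp only
  rw [Nat.sub_add_cancel h1]

variable [Fintype S] [Fintype A]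

theorem DependsOnPast.exists_bound {n : ℕ} {Φ : (ℕ → Traj S A H) → ℝ}
    (hΦ : DependsOnPast n Φ) [Nonempty (Traj S A H)] : ∃ C, ∀ y, |Φ y| ≤ C := by
  classical
  obtain ⟨Ψ, hΨ⟩ := hΦ.exists_factor
  refine ⟨∑ v, |Ψ v|, fun y => ?_⟩
  rw [hΨ y]
  exact Finset.single_le_sum (f := fun v => |Ψ v|) (fun v _ => abs_nonneg _) (Finset.mem_univ _)

variable {Ω : Type*} {mΩ : MeasurableSpace Ω} {M : LayeredMDP S A H} {T : ℕ} {μ : Measure Ω}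
  {𝓕 : Filtration ℕ mΩ} {π : ℕ → Ω → S → A → ℝ} {x : ℕ → Ω → Traj S A H}

theorem IsInteraction.measurable_of_dependsOnPast (hx : IsInteraction M T μ 𝓕 π x) {n : ℕ}
    {Φ : (ℕ → Traj S A H) → ℝ} (hΦ : DependsOnPast n Φ) [Nonempty (Traj S A H)] :
    Measurable[𝓕 n] fun ω => Φ fun τ => x τ ω := by
  obtain ⟨Ψ, hΨ⟩ := hΦ.exists_factor
  simp only [hΨ]
  let _ : MeasurableSpace (Fin n → Traj S A H) := ⊤
  have hr : Measurable[𝓕 n] fun ω => (fun i : Fin n => x (i + 1) ω) := by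
    refine @measurable_to_countable' _ _ _ _ (𝓕 n) _ fun v => ?_
    have : (fun ω => (fun i : Fin n => x (i + 1) ω)) ⁻¹' {v} =
        ⋂ i : Fin n, {ω | x (i + 1) ω = v i} := by
      ext ω
      simp [funext_iff]
    rw [this]
    exact @MeasurableSet.iInter _ _ (𝓕 n) _ _ fun i =>
      𝓕.mono (by omega) _ (hx.traj_measurable (i + 1) (by omega) (v i))
  exact (measurable_from_top (f := Ψ)).comp hr

theorem IsInteraction.integrable_of_dependsOnPast [IsProbabilityMeasure μ]
    (hx : IsInteraction M T μ 𝓕 π x) {n : ℕ} {Φ : (ℕ → Traj S A H) → ℝ}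
    (hΦ : DependsOnPast n Φ) [Nonempty (Traj S A H)] :
    Integrable (fun ω => Φ fun τ => x τ ω) μ := by
  obtain ⟨C, hC⟩ := hΦ.exists_bound
  refine Integrable.of_bound
    ((hx.measurable_of_dependsOnPast hΦ).mono (𝓕.le n) le_rfl).aestronglyMeasurable C ?_
  exact Filter.Eventually.of_forall fun ω => hC _

/-- Integration of the trajectory of epoch `n + 1` against functions of the earlier epochs. -/
theorem IsInteraction.integral_mul_indicator [IsProbabilityMeasure μ]
    (hx : IsInteraction M T μ 𝓕 π x) {n : ℕ} (hn : n + 1 ≤ T) {Φ : (ℕ → Traj S A H) → ℝ}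
    (hΦ : DependsOnPast n Φ) (o : Traj S A H) :
    Integrable (fun ω => Φ (fun τ => x τ ω) * M.trajProb (π (n + 1) ω) o) μ ∧
    ∫ ω, Φ (fun τ => x τ ω) * Set.indicator {ω | x (n + 1) ω = o} (fun _ => (1 : ℝ)) ω ∂μ =
      ∫ ω, Φ (fun τ => x τ ω) * M.trajProb (π (n + 1) ω) o ∂μ := by
  have : Nonempty (Traj S A H) := ⟨o⟩
  have hm := hx.measurable_of_dependsOnPast hΦ
  obtain ⟨C, hC⟩ := hΦ.exists_bound
  have hset : MeasurableSet {ω | x (n + 1) ω = o} :=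
    𝓕.le (n + 1) _ (hx.traj_measurable (n + 1) (by omega) o)
  have hind : Integrable (Set.indicator {ω | x (n + 1) ω = o} fun _ => (1 : ℝ)) μ :=
    (integrable_const 1).indicator hset
  have hprod : Integrable ((fun ω => Φ fun τ => x τ ω) *
      Set.indicator {ω | x (n + 1) ω = o} fun _ => (1 : ℝ)) μ :=
    hind.bdd_mul (c := C) (hm.mono (𝓕.le n) le_rfl).aestronglyMeasurable
      (Filter.Eventually.of_forall fun ω => hC _)
  have hpull := condExp_mul_of_stronglyMeasurable_left (μ := μ) (m := 𝓕 n) hm.stronglyMeasurable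
    hprod hind
  have hlaw := hx.traj_law (n + 1) (by omega) hn o
  rw [Nat.add_sub_cancel] at hlaw
  have hae : μ[(fun ω => Φ fun τ => x τ ω) *
      Set.indicator {ω | x (n + 1) ω = o} (fun _ => (1 : ℝ)) | 𝓕 n] =ᵐ[μ]
      fun ω => Φ (fun τ => x τ ω) * M.trajProb (π (n + 1) ω) o := by
    filter_upwards [hpull, hlaw] with ω h1 h2
    rw [h1, Pi.mul_apply, h2]
  refine ⟨integrable_condExp.congr hae, ?_⟩
  rw [← integral_congr_ae hae, integral_condExp (𝓕.le n)]
  rfl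

/-- A product of factors which are nonnegative, determined by the past up to the current
trajectory, and of conditional mean at most `1` has mean at most `1`. -/
theorem IsInteraction.integral_prod_le_one [IsProbabilityMeasure μ]
    (hx : IsInteraction M T μ 𝓕 π x) {F : (ℕ → Traj S A H) → ℕ → Traj S A H → ℝ}
    (hF0 : ∀ y k o, 0 ≤ F y k o)
    (hFd : ∀ k o, DependsOnPast k fun y => F y (k + 1) o)
    (hF1 : ∀ y k (ρ : S → A → ℝ), (∀ s, ρ s ∈ stdSimplex ℝ A) →
      ∑ o, M.trajProb ρ o * F y k o ≤ 1) (n : ℕ) (hn : n ≤ T) :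
    Integrable (fun ω => ∏ k ∈ Finset.Icc 1 n, F (fun τ => x τ ω) k (x k ω)) μ ∧
    ∫ ω, ∏ k ∈ Finset.Icc 1 n, F (fun τ => x τ ω) k (x k ω) ∂μ ≤ 1 := by
  classical
  have hne : Nonempty (Traj S A H) := by
    have : Nonempty Ω := μ.nonempty_of_neZero
    exact this.map (x 0)
  have hdep : ∀ n, DependsOnPast n fun y : ℕ → Traj S A H =>
      ∏ k ∈ Finset.Icc 1 n, F y k (y k) := by
    intro n y z hyz
    refine Finset.prod_congr rfl fun k hk => ?_
    rw [Finset.mem_Icc] at hk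
    obtain ⟨j, rfl⟩ : ∃ j, k = j + 1 := ⟨k - 1, by omega⟩
    rw [hyz (j + 1) hk.1 hk.2]
    exact hFd j _ y z fun i h1 h2 => hyz i h1 (by omega)
  refine ⟨hx.integrable_of_dependsOnPast (hdep n), ?_⟩
  induction n with
  | zero => simp
  | succ n ih =>
    set W : (ℕ → Traj S A H) → ℝ := fun y => ∏ k ∈ Finset.Icc 1 n, F y k (y k) with hW
    have hW0 : ∀ y, 0 ≤ W y := fun y => Finset.prod_nonneg fun k _ => hF0 _ _ _
    have hWF : ∀ o, DependsOnPast n fun y => W y * F y (n + 1) o := by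
      intro o y z hyz
      exact congrArg₂ (· * ·) (hdep n y z hyz) (hFd n o y z hyz)
    -- Splitting by the value `o` of the new trajectory turns each coefficient into a function of
    -- the past, to which the conditional law applies.
    have hsplit : ∀ ω, ∏ k ∈ Finset.Icc 1 (n + 1), F (fun τ => x τ ω) k (x k ω) =
        ∑ o, (W (fun τ => x τ ω) * F (fun τ => x τ ω) (n + 1) o) *
          Set.indicator {ω | x (n + 1) ω = o} (fun _ => (1 : ℝ)) ω := by
      intro ω
      rw [Finset.prod_Icc_succ_top (by omega), Finset.sum_eq_single (x (n + 1) ω)]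
      · simp [hW]
      · intro o _ ho
        rw [Set.indicator_of_notMem (by simpa using ho.symm), mul_zero]
      · simp
    have hint := fun o => hx.integral_mul_indicator hn (hWF o) o
    have hi1 : ∀ o ∈ (Finset.univ : Finset (Traj S A H)), Integrable (fun ω =>
        (W (fun τ => x τ ω) * F (fun τ => x τ ω) (n + 1) o) *
          Set.indicator {ω | x (n + 1) ω = o} (fun _ => (1 : ℝ)) ω) μ := by
      intro o _
      obtain ⟨C, hC⟩ := (hWF o).exists_bound
      refine Integrable.bdd_mul (c := C) ((integrable_const 1).indicator
        (𝓕.le (n + 1) _ (hx.traj_measurable (n + 1) (by omega) o)))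
        ((hx.measurable_of_dependsOnPast (hWF o)).mono (𝓕.le n) le_rfl).aestronglyMeasurable
        (Filter.Eventually.of_forall fun ω => hC _)
    calc ∫ ω, ∏ k ∈ Finset.Icc 1 (n + 1), F (fun τ => x τ ω) k (x k ω) ∂μ
        = ∑ o, ∫ ω, (W (fun τ => x τ ω) * F (fun τ => x τ ω) (n + 1) o) *
            M.trajProb (π (n + 1) ω) o ∂μ := by
          simp only [hsplit]
          rw [integral_finsetSum _ hi1]
          exact Finset.sum_congr rfl fun o _ => (hint o).2
      _ = ∫ ω, ∑ o, (W (fun τ => x τ ω) * F (fun τ => x τ ω) (n + 1) o) *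
            M.trajProb (π (n + 1) ω) o ∂μ :=
          (integral_finsetSum _ fun o _ => (hint o).1).symm
      _ ≤ ∫ ω, W (fun τ => x τ ω) ∂μ := by
          refine integral_mono (integrable_finsetSum _ fun o _ => (hint o).1)
            (hx.integrable_of_dependsOnPast (hdep n)) fun ω => ?_
          have h1 := hF1 (fun τ => x τ ω) (n + 1) (π (n + 1) ω) (hx.policy_mem (n + 1) ω)
          have h2 : ∑ o, (W (fun τ => x τ ω) * F (fun τ => x τ ω) (n + 1) o) *
              M.trajProb (π (n + 1) ω) o = W (fun τ => x τ ω) *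
              ∑ o, M.trajProb (π (n + 1) ω) o * F (fun τ => x τ ω) (n + 1) o := by
            rw [Finset.mul_sum]
            exact Finset.sum_congr rfl fun o _ => by ring
          simp only [h2]
          exact mul_le_of_le_one_right (hW0 _) h1
      _ ≤ 1 := ih (by omega)

theorem IsInteraction.measureReal_prod_ge_le [IsProbabilityMeasure μ]
    (hx : IsInteraction M T μ 𝓕 π x) {F : (ℕ → Traj S A H) → ℕ → Traj S A H → ℝ}
    (hF0 : ∀ y k o, 0 ≤ F y k o)
    (hFd : ∀ k o, DependsOnPast k fun y => F y (k + 1) o)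
    (hF1 : ∀ y k (ρ : S → A → ℝ), (∀ s, ρ s ∈ stdSimplex ℝ A) →
      ∑ o, M.trajProb ρ o * F y k o ≤ 1) (n : ℕ) (hn : n ≤ T) (b : ℝ) :
    μ.real {ω | Real.exp b ≤ ∏ k ∈ Finset.Icc 1 n, F (fun τ => x τ ω) k (x k ω)} ≤
      Real.exp (-b) := by
  obtain ⟨h1, h2⟩ := hx.integral_prod_le_one hF0 hFd hF1 n hn
  have h3 := mul_meas_ge_le_integral_of_nonneg
    (Filter.Eventually.of_forall fun ω => Finset.prod_nonneg fun k _ => hF0 _ _ _) h1 (Real.exp b)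
  rw [Real.exp_neg, ← one_div, le_div_iff₀' (Real.exp_pos b)]
  exact h3.trans h2

end ProductBound

/-! ### Exponential moments of a single transition. -/

section OneStep

variable {S A : Type*} [Fintype S] {H : ℕ}

open Classical in
/-- Number of epochs in `1, …, n` which satisfy `p` and start after both `s` and `s'` have been
visited. -/
noncomputable def countAfter (x : ℕ → Traj S A H) (s s' : S) (p : Traj S A H → Prop) (n : ℕ) : ℕ :=
  ((Finset.Icc 1 n).filter fun k =>
    (s ∈ visitedBefore x k ∧ s' ∈ visitedBefore x k) ∧ p (x k)).card

/-- Uses `e^l ≤ 1 + l + l²` for `|l| ≤ 1`, then `1 + z ≤ e^z`. Both signs of `l` are allowed, so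
both tails are covered. -/
theorem LayeredMDP.sum_P_mul_exp_le_one (M : LayeredMDP S A H) {s s' : S} {a : A}
    (hs : (M.layer s' : ℕ) = M.layer s + 1) {l : ℝ} (hl : |l| ≤ 1) [DecidableEq S] :
    ∑ r, M.P s a r *
      Real.exp (l * (if r = s' then 1 else 0) - (l + l ^ 2) * M.P s a s') ≤ 1 := by
  have hsum := M.P_sum s a (by have := (M.layer s').2; omega)
  set p := M.P s a s' with hp
  have h1 : ∀ r, M.P s a r * Real.exp (l * (if r = s' then 1 else 0) - (l + l ^ 2) * p) =
      Real.exp (-((l + l ^ 2) * p)) *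
        (M.P s a r + if r = s' then M.P s a s' * (Real.exp l - 1) else 0) := by
    intro r
    rw [sub_eq_add_neg, Real.exp_add]
    split_ifs with h
    · subst h
      rw [mul_one]; ring
    · rw [mul_zero, Real.exp_zero]; ring
  rw [Finset.sum_congr rfl fun r _ => h1 r, ← Finset.mul_sum, Finset.sum_add_distrib, hsum,
    Finset.sum_ite_eq' Finset.univ s', if_pos (Finset.mem_univ _), ← hp]
  have h2 := abs_le.1 (Real.abs_exp_sub_one_sub_id_le hl)
  have hp0 : 0 ≤ p := M.P_nonneg _ _ _
  have h3 : 1 + p * (Real.exp l - 1) ≤ Real.exp ((l + l ^ 2) * p) := by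
    have := Real.add_one_le_exp ((l + l ^ 2) * p)
    nlinarith
  calc _ ≤ Real.exp (-((l + l ^ 2) * p)) * Real.exp ((l + l ^ 2) * p) := by gcongr
    _ = 1 := by rw [← Real.exp_add, neg_add_cancel, Real.exp_zero]

open Classical in
/-- Probability of a transition from `(s, a)` to a state outside `V`. -/
noncomputable def LayeredMDP.missingMass (M : LayeredMDP S A H) (V : Finset S) (s : S) (a : A) : ℝ :=
  ∑ r ∈ Finset.univ.filter (fun r => r ∉ V), M.P s a r

-- The mean of `exp(-1{r ∉ V})` is `1 - (1 - e⁻¹) U ≤ 1 - U/2 ≤ e^(-U/2)`, because `e⁻¹ ≤ 1/2`.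
open Classical in
theorem LayeredMDP.sum_P_mul_exp_missingMass_le_one (M : LayeredMDP S A H) (V : Finset S) {s : S}
    {a : A} (hs : (M.layer s : ℕ) + 1 < H) :
    ∑ r, M.P s a r * Real.exp (M.missingMass V s a / 2 - if r ∉ V then 1 else 0) ≤ 1 := by
  have hsum := M.P_sum s a hs
  set U := M.missingMass V s a with hU
  have hU0 : 0 ≤ U := Finset.sum_nonneg fun r _ => M.P_nonneg _ _ _
  have h1 : ∀ r, M.P s a r * Real.exp (U / 2 - if r ∉ V then 1 else 0) =
      Real.exp (U / 2) * (M.P s a r - (1 - Real.exp (-1)) * if r ∉ V then M.P s a r else 0) := by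
    intro r
    rw [sub_eq_add_neg, Real.exp_add]
    split_ifs with h
    · simp [mul_comm]
    · ring
  rw [Finset.sum_congr rfl fun r _ => h1 r, ← Finset.mul_sum, Finset.sum_sub_distrib, hsum,
    ← Finset.mul_sum, ← Finset.sum_filter]
  change Real.exp (U / 2) * (1 - (1 - Real.exp (-1)) * U) ≤ 1
  have h2 : Real.exp (-1) ≤ 1 / 2 := by
    rw [Real.exp_neg, ← one_div]
    exact one_div_le_one_div_of_le two_pos (by linarith [Real.add_one_le_exp 1])
  have h3 : 1 - (1 - Real.exp (-1)) * U ≤ Real.exp (-(U / 2)) := by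
    have := Real.add_one_le_exp (-(U / 2))
    nlinarith
  calc _ ≤ Real.exp (U / 2) * Real.exp (-(U / 2)) := by gcongr
    _ = 1 := by rw [← Real.exp_add, add_neg_cancel, Real.exp_zero]

end OneStep

/-! ### Tail bounds for states selected by their arrival index. -/

section Tails

variable {S A : Type*} [Fintype S] [Fintype A] {H : ℕ} {Ω : Type*} {mΩ : MeasurableSpace Ω}
  {M : LayeredMDP S A H} {T : ℕ} {μ : Measure Ω} [IsProbabilityMeasure μ]
  {𝓕 : Filtration ℕ mΩ} {π : ℕ → Ω → S → A → ℝ} {x : ℕ → Ω → Traj S A H}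

open Classical in
/-- Exponential tail bound for sums that follow a random object `q`, which is identified by `cond`
on the basis of the past epochs and never changes. -/
theorem IsInteraction.measureReal_selected_le (hx : IsInteraction M T μ 𝓕 π x)
    {Q : Type*} [Fintype Q] {cond : (ℕ → Traj S A H) → ℕ → Q → Prop}
    (hcd : ∀ k q, DependsOnPast k fun y => cond y (k + 1) q)
    (hcu : ∀ y k k' q q', cond y k q → cond y k' q' → q = q')
    {e : Q → (ℕ → Traj S A H) → ℕ → Traj S A H → ℝ}
    (hed : ∀ k q o, DependsOnPast k fun y => e q y (k + 1) o)
    (he1 : ∀ y k q, cond y k q → ∀ ρ : S → A → ℝ, (∀ s, ρ s ∈ stdSimplex ℝ A) →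
      ∑ o, M.trajProb ρ o * Real.exp (e q y k o) ≤ 1) (n : ℕ) (hn : n ≤ T) (b : ℝ) :
    μ.real {ω | ∃ q, (∃ k, cond (fun τ => x τ ω) k q) ∧
      b ≤ ∑ k ∈ (Finset.Icc 1 n).filter (fun k => cond (fun τ => x τ ω) k q),
        e q (fun τ => x τ ω) k (x k ω)} ≤ Real.exp (-b) := by
  -- At most one `q` is ever selected on a path, so at most one factor differs from 1. This single
  -- process therefore serves all `q` at once, with no union bound over `Q`.
  set F : (ℕ → Traj S A H) → ℕ → Traj S A H → ℝ := fun y k o =>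
    ∏ q, if cond y k q then Real.exp (e q y k o) else 1 with hF
  have hFq : ∀ y k o q, (∃ k', cond y k' q) →
      F y k o = if cond y k q then Real.exp (e q y k o) else 1 := by
    rintro y k o q ⟨k', hk'⟩
    refine Finset.prod_eq_single q (fun q' _ hq' => ?_) (fun h => absurd (Finset.mem_univ q) h)
    exact if_neg fun hc => hq' (hcu y k k' q' q hc hk')
  have hF0 : ∀ y k o, 0 ≤ F y k o := fun y k o => Finset.prod_nonneg fun q _ => by
    split_ifs
    · exact (Real.exp_pos _).le
    · exact zero_le_one
  refine le_trans (measureReal_mono ?_) (hx.measureReal_prod_ge_le hF0 ?_ ?_ n hn b)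
  · rintro ω ⟨q, hq, hb⟩
    simp only [Set.mem_ofPred_eq, hFq _ _ _ q hq]
    rw [← Finset.prod_filter, ← Real.exp_sum]
    exact Real.exp_le_exp.2 hb
  · intro k o y z hyz
    refine Finset.prod_congr rfl fun q _ => ?_
    have h1 := hcd k q y z hyz
    have h2 := hed k q o y z hyz
    simp only at h1 h2
    simp only [h1, h2]
  · intro y k ρ hρ
    by_cases hq : ∃ q, cond y k q
    · obtain ⟨q, hq⟩ := hq
      simp only [hFq y k _ q ⟨k, hq⟩, if_pos hq]
      exact he1 y k q hq ρ hρ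
    · push Not at hq
      simp only [hF, hq, if_false, Finset.prod_const_one, mul_one]
      exact (M.sum_trajProb hρ).le

/-- Chernoff bound for the visits of a transition between the states with indices `i` and `j`. -/
theorem IsInteraction.measureReal_transition_tail_le (hx : IsInteraction M T μ 𝓕 π x) (i j : ℕ)
    (a : A) {l : ℝ → ℝ} (hl : ∀ p, |l p| ≤ 1) (n : ℕ) (hn : n ≤ T) (b : ℝ) :
    μ.real {ω | ∃ t s s', (s ∈ visitedBefore (fun τ => x τ ω) t ∧
        s' ∈ visitedBefore (fun τ => x τ ω) t) ∧
        arrivalIndex (fun τ => x τ ω) s = i ∧ arrivalIndex (fun τ => x τ ω) s' = j ∧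
        (M.layer s' : ℕ) = M.layer s + 1 ∧
        b ≤ l (M.P s a s') * countAfter (fun τ => x τ ω) s s' (fun o => VisitsSAS o s a s') n -
          (l (M.P s a s') + l (M.P s a s') ^ 2) * M.P s a s' *
            countAfter (fun τ => x τ ω) s s' (fun o => VisitsSA o s a) n} ≤ Real.exp (-b) := by
  classical
  set cond : (ℕ → Traj S A H) → ℕ → S × S → Prop := fun y k q =>
    ((q.1 ∈ visitedBefore y k ∧ q.2 ∈ visitedBefore y k) ∧
      arrivalIndex y q.1 = i ∧ arrivalIndex y q.2 = j) ∧
      (M.layer q.2 : ℕ) = M.layer q.1 + 1 with hcond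
  set e : S × S → (ℕ → Traj S A H) → ℕ → Traj S A H → ℝ := fun q _ _ o =>
    l (M.P q.1 a q.2) * (if VisitsSAS o q.1 a q.2 then 1 else 0) -
      (l (M.P q.1 a q.2) + l (M.P q.1 a q.2) ^ 2) * M.P q.1 a q.2 *
        (if VisitsSA o q.1 a then 1 else 0) with he
  refine le_trans (measureReal_mono ?_)
    (hx.measureReal_selected_le (cond := cond) (e := e) ?_ ?_ ?_ ?_ n hn b)
  · rintro ω ⟨t, s, s', hv, hi, hj, hlay, hb⟩
    refine ⟨(s, s'), ⟨t, ⟨hv, hi, hj⟩, hlay⟩, hb.trans_eq ?_⟩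
    simp only [he, hcond, hi, hj, hlay, and_true]
    rw [Finset.sum_sub_distrib, ← Finset.mul_sum, ← Finset.mul_sum, Finset.sum_boole,
      Finset.sum_boole, Finset.filter_filter, Finset.filter_filter]
    rfl
  · intro k q y z hyz
    have hyz' : ∀ m, 1 ≤ m → m < k + 1 → y m = z m := fun m h1 h2 => hyz m h1 (by omega)
    simp only [hcond, eq_iff_iff]
    refine and_congr_left fun _ => ?_
    rw [visitedBefore_congr hyz']
    refine and_congr_right fun h => ?_
    rw [← visitedBefore_congr hyz'] at h
    rw [arrivalIndex_congr hyz' h.1, arrivalIndex_congr hyz' h.2]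
  · rintro y k k' q q' ⟨⟨⟨h1, h2⟩, h3, h4⟩, -⟩ ⟨⟨⟨h1', h2'⟩, h3', h4'⟩, -⟩
    have m1 := visitedBefore_mono y (le_max_left k k')
    have m2 := visitedBefore_mono y (le_max_right k k')
    exact Prod.ext
      (arrivalIndex_injOn y (max k k') (m1 h1) (m2 h1') (h3.trans h3'.symm))
      (arrivalIndex_injOn y (max k k') (m1 h2) (m2 h2') (h4.trans h4'.symm))
  · intro k q o y z _
    rfl
  · rintro y k ⟨s, s'⟩ ⟨-, hlay⟩ ρ hρ
    simp only at hlay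
    have hs : (M.layer s : ℕ) + 1 < H := by have := (M.layer s').2; omega
    refine M.sum_trajProb_mul_le_one hρ s a hs _
      (M.sum_P_mul_exp_le_one (a := a) hlay (hl (M.P s a s'))) _ ?_ ?_
    · intro o _ ho
      simp only [he]
      rw [if_neg ho, if_neg (fun h => ho h.visitsSA)]
      simp
    · intro o r ho hor
      simp only [he]
      rw [if_pos hor.visitsSA, mul_one]
      have : VisitsSAS o s a s' ↔ r = s' := by
        rw [ho.visitsSAS_iff hs, ← ((ho.visitsSAS_iff hs).1 hor).2]
        exact ⟨fun h => h.2, fun h => ⟨((ho.visitsSAS_iff hs).1 hor).1, h⟩⟩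
      simp only [this]

open Classical in
/-- Tail bound for the missing mass at the state with index `i`. -/
theorem IsInteraction.measureReal_missingMass_tail_le (hx : IsInteraction M T μ 𝓕 π x) (i : ℕ)
    (a : A) (n : ℕ) (hn : n ≤ T) (b : ℝ) :
    μ.real {ω | ∃ t s, s ∈ visitedBefore (fun τ => x τ ω) t ∧
        arrivalIndex (fun τ => x τ ω) s = i ∧ (M.layer s : ℕ) + 1 < H ∧
        b ≤ ∑ k ∈ (Finset.Icc 1 n).filter (fun k => s ∈ visitedBefore (fun τ => x τ ω) k),
          (M.missingMass (visitedBefore (fun τ => x τ ω) k) s a / 2 *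
            (if VisitsSA (x k ω) s a then 1 else 0) -
          if ∃ r, r ∉ visitedBefore (fun τ => x τ ω) k ∧ VisitsSAS (x k ω) s a r then 1 else 0)} ≤
      Real.exp (-b) := by
  set cond : (ℕ → Traj S A H) → ℕ → S → Prop := fun y k s =>
    (s ∈ visitedBefore y k ∧ arrivalIndex y s = i) ∧ (M.layer s : ℕ) + 1 < H with hcond
  set e : S → (ℕ → Traj S A H) → ℕ → Traj S A H → ℝ := fun s y k o =>
    M.missingMass (visitedBefore y k) s a / 2 * (if VisitsSA o s a then 1 else 0) -
      if ∃ r, r ∉ visitedBefore y k ∧ VisitsSAS o s a r then 1 else 0 with he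
  refine le_trans (measureReal_mono ?_)
    (hx.measureReal_selected_le (cond := cond) (e := e) ?_ ?_ ?_ ?_ n hn b)
  · rintro ω ⟨t, s, hv, hi, hlay, hb⟩
    refine ⟨s, ⟨t, ⟨hv, hi⟩, hlay⟩, hb.trans_eq ?_⟩
    simp only [he, hcond, hi, hlay, and_true]
  · intro k q y z hyz
    have hyz' : ∀ m, 1 ≤ m → m < k + 1 → y m = z m := fun m h1 h2 => hyz m h1 (by omega)
    simp only [hcond, eq_iff_iff]
    refine and_congr_left fun _ => ?_
    rw [visitedBefore_congr hyz']
    refine and_congr_right fun h => ?_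
    rw [← visitedBefore_congr hyz'] at h
    rw [arrivalIndex_congr hyz' h]
  · rintro y k k' s s' ⟨⟨h1, h2⟩, -⟩ ⟨⟨h1', h2'⟩, -⟩
    exact arrivalIndex_injOn y (max k k') (visitedBefore_mono y (le_max_left k k') h1)
      (visitedBefore_mono y (le_max_right k k') h1') (h2.trans h2'.symm)
  · intro k q o y z hyz
    have hyz' : ∀ m, 1 ≤ m → m < k + 1 → y m = z m := fun m h1 h2 => hyz m h1 (by omega)
    simp only [he]
    rw [visitedBefore_congr hyz']
  · rintro y k s ⟨-, hlay⟩ ρ hρ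
    refine M.sum_trajProb_mul_le_one hρ s a hlay _
      (M.sum_P_mul_exp_missingMass_le_one (visitedBefore y k) hlay) _ ?_ ?_
    · intro o _ ho
      simp only [he]
      rw [if_neg ho, if_neg (fun ⟨r, _, h⟩ => ho h.visitsSA)]
      simp
    · intro o r ho hor
      simp only [he]
      rw [if_pos hor.visitsSA, mul_one]
      have : (∃ r, r ∉ visitedBefore y k ∧ VisitsSAS o s a r) ↔ r ∉ visitedBefore y k := by
        constructor
        · rintro ⟨r', hr', h⟩
          rw [← ((ho.visitsSAS_iff hlay).1 hor).2, ((ho.visitsSAS_iff hlay).1 h).2]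
          exact hr'
        · exact fun h => ⟨r, h, hor⟩
      simp only [this]

end Tails

/-! ### Deterministic inequalities behind the widths. -/

section RealBounds

/-- Exponent used for the Chernoff bound of a sum of `ν` indicators with success probability `p`
at logarithmic confidence `b`. -/
noncomputable def tiltParam (b ν p : ℝ) : ℝ :=
  if b ≤ p * ν then √(b / (p * ν)) else 1

theorem tiltParam_nonneg (b ν p : ℝ) : 0 ≤ tiltParam b ν p := by
  unfold tiltParam
  split_ifs
  · exact Real.sqrt_nonneg _
  · exact zero_le_one

theorem tiltParam_le_one {b : ℝ} (hb : 0 < b) (ν p : ℝ) : tiltParam b ν p ≤ 1 := by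
  unfold tiltParam
  split_ifs with h
  · refine Real.sqrt_le_iff.2 ⟨zero_le_one, ?_⟩
    rw [one_pow]
    exact div_le_one_of_le₀ h (hb.le.trans h)
  · exact le_rfl

/-- If `3L ≤ pν`, the tilt balances the two terms on the right and gives `|m - pν| ≤ 2√(3L pν)`;
solving this quadratic inequality replaces `pν` by the observed `m`. Otherwise the tilt is 1 and the
deviation is at most `3L + pν < 6L`. -/
theorem abs_sub_le_of_tilted {L p ν m : ℝ} (hL : 0 < L) (hm : 0 ≤ m)
    (h : tiltParam (3 * L) ν p * |m - p * ν| ≤ 3 * L + tiltParam (3 * L) ν p ^ 2 * (p * ν)) :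
    |m - p * ν| ≤ 4 * √(L * m) + 12 * L := by
  unfold tiltParam at h
  split_ifs at h with hc
  · set y := p * ν
    have hy : 0 < y := by linarith
    set r := √(3 * L) with hr
    set s := √y with hs
    have hr0 : 0 < r := Real.sqrt_pos.2 (by linarith)
    have hs0 : 0 < s := Real.sqrt_pos.2 hy
    have hr2 : r ^ 2 = 3 * L := Real.sq_sqrt (by linarith)
    have hs2 : s ^ 2 = y := Real.sq_sqrt hy.le
    rw [Real.sqrt_div (by linarith), ← hr, ← hs, div_pow, hr2, hs2,
      div_mul_cancel₀ _ hy.ne', ← hr2, div_mul_eq_mul_div, div_le_iff₀ hs0] at h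
    have h1 : |m - y| ≤ 2 * r * s := by
      refine le_of_mul_le_mul_left ?_ hr0
      linarith
    have h2 := (abs_le.1 h1).1
    set q := √m with hq
    have hq0 : 0 ≤ q := Real.sqrt_nonneg _
    have hq2 : q ^ 2 = m := Real.sq_sqrt hm
    -- The lower deviation reads `s² - 2rs ≤ q²`.
    have h3 : s ≤ 2 * r + q := by
      by_contra! hlt
      nlinarith
    set w := √L with hw
    have hw0 : 0 ≤ w := Real.sqrt_nonneg _
    have hw2 : w ^ 2 = L := Real.sq_sqrt hL.le
    have h4 : r ≤ 2 * w := by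
      refine abs_le_of_sq_le_sq' ?_ (by positivity) |>.2
      nlinarith
    rw [Real.sqrt_mul hL.le, ← hw, ← hq]
    have h5 : r * s ≤ r * (2 * r + q) := mul_le_mul_of_nonneg_left h3 hr0.le
    have h6 : r * q ≤ 2 * w * q := mul_le_mul_of_nonneg_right h4 hq0
    nlinarith
  · have := Real.sqrt_nonneg (L * m)
    linarith

/-- Passes from counts to frequencies. Here `u` and `v` are the contributions of the one epoch that
the definition may count in addition. -/
theorem abs_sub_div_le {L p n₀ m₀ u v : ℝ} (hL : 1 ≤ L) (hp0 : 0 ≤ p) (hp1 : p ≤ 1)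
    (hm₀ : 0 ≤ m₀) (hmn : m₀ ≤ n₀) (hu : 0 ≤ u) (huv : u ≤ v) (hv : v ≤ 1)
    (h : |m₀ - p * n₀| ≤ 4 * √(L * m₀) + 12 * L) :
    |p - (m₀ + u) / max 1 (n₀ + v)| ≤
      4 * √((m₀ + u) / max 1 (n₀ + v) * L / max (n₀ + v - 1) 1) +
        20 * L / max (n₀ + v - 1) 1 := by
  rcases le_total (n₀ + v) 2 with hn | hn
  · have hq0 : 0 ≤ (m₀ + u) / max 1 (n₀ + v) := by positivity
    have hq1 : (m₀ + u) / max 1 (n₀ + v) ≤ 1 :=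
      div_le_one_of_le₀ ((add_le_add hmn huv).trans (le_max_right _ _)) (by positivity)
    rw [max_eq_right (by linarith : n₀ + v - 1 ≤ 1)]
    have h1 : |p - (m₀ + u) / max 1 (n₀ + v)| ≤ 1 := abs_le.2 ⟨by linarith, by linarith⟩
    have h2 := Real.sqrt_nonneg ((m₀ + u) / max 1 (n₀ + v) * L / 1)
    linarith
  · rw [max_eq_right (by linarith : (1 : ℝ) ≤ n₀ + v),
      max_eq_left (by linarith : (1 : ℝ) ≤ n₀ + v - 1)]
    set n := n₀ + v with hn'
    set m := m₀ + u with hm'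
    have hnpos : 0 < n := by linarith
    have hDpos : 0 < n - 1 := by linarith
    -- The extra visit costs at most 1, hence at most `L`: this turns 12 into 13.
    have h1 : |p * n - m| ≤ 4 * √(L * m) + 13 * L := by
      have e : p * n - m = -(m₀ - p * n₀) + (p * v - u) := by rw [hn', hm']; ring
      have hpv : |p * v - u| ≤ 1 := abs_le.2 ⟨by nlinarith, by nlinarith⟩
      have hsq : √(L * m₀) ≤ √(L * m) := Real.sqrt_le_sqrt (by nlinarith)
      rw [e]
      refine (abs_add_le _ _).trans ?_
      rw [abs_neg]
      linarith
    have h2 : |p - m / n| = |p * n - m| / n := by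
      rw [← abs_of_pos hnpos, ← abs_div, abs_of_pos hnpos, sub_div, mul_div_cancel_right₀ _ hnpos.ne']
    have h3 : √(L * m) / n ≤ √(m / n * L / (n - 1)) := by
      refine Real.le_sqrt_of_sq_le ?_
      rw [div_pow, Real.sq_sqrt (by positivity)]
      have : L * m / n ^ 2 = m / n * L / n := by field_simp
      rw [this]
      exact div_le_div_of_nonneg_left (by positivity) hDpos (by linarith)
    have h4 : 13 * L / n ≤ 20 * L / (n - 1) :=
      div_le_div₀ (by positivity) (by linarith) hDpos (by linarith)
    calc |p - m / n| ≤ (4 * √(L * m) + 13 * L) / n := by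
          rw [h2]; gcongr
      _ = 4 * (√(L * m) / n) + 13 * L / n := by ring
      _ ≤ _ := by linarith

theorem sum_one_div_sq_le_two (n : ℕ) : ∑ k ∈ Finset.Icc 1 n, 1 / (k : ℝ) ^ 2 ≤ 2 := by
  suffices h : ∑ k ∈ Finset.Icc 1 n, 1 / (k : ℝ) ^ 2 ≤ 2 - 1 / (n : ℝ) by
    have : (0 : ℝ) ≤ 1 / (n : ℝ) := by positivity
    linarith
  induction n with
  | zero => simp
  | succ n ih =>
    rw [Finset.sum_Icc_succ_top (by omega)]
    -- Since `1 / 0 = 0`, the telescoping inequality fails at `n = 0`.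
    rcases Nat.eq_zero_or_pos n with rfl | hn
    · norm_num
    · have hn' : (0 : ℝ) < n := by exact_mod_cast hn
      have : 1 / ((n + 1 : ℕ) : ℝ) ^ 2 ≤ 1 / n - 1 / ((n + 1 : ℕ) : ℝ) := by
        push_cast
        rw [div_sub_div _ _ hn'.ne' (by positivity), div_le_div_iff₀ (by positivity) (by positivity)]
        nlinarith
      linarith

end RealBounds

/-! ### From count deviations to the two confidence intervals. -/

section Counting

-- A difference of counts under `before` includes epoch `t'` itself, under `through` it does not;
-- the last term records this.
open Classical in
theorem card_filter_Icc_last (c : CountConvention) (q : ℕ → Prop) {t' t : ℕ} (h1 : 1 ≤ t')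
    (h2 : t' < t) :
    ((Finset.Icc 1 (c.last t)).filter q).card = ((Finset.Icc 1 (c.last t')).filter q).card +
      ((Finset.Icc 1 (c.last t)).filter fun k => t' < k ∧ q k).card +
      (if c = .before ∧ q t' then 1 else 0) := by
  have hle : t' ≤ c.last t := by cases c <;> simp only [CountConvention.last] <;> omega
  have hsplit : ((Finset.Icc 1 (c.last t)).filter q).card =
      ((Finset.Icc 1 t').filter q).card +
      ((Finset.Icc 1 (c.last t)).filter fun k => t' < k ∧ q k).card := by
    rw [← Finset.card_union_of_disjoint]
    · congr 1
      ext k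
      simp only [Finset.mem_filter, Finset.mem_Icc, Finset.mem_union]
      constructor
      · rintro ⟨⟨hk1, hk2⟩, hq⟩
        rcases le_or_gt k t' with h | h
        · exact Or.inl ⟨⟨hk1, h⟩, hq⟩
        · exact Or.inr ⟨⟨hk1, hk2⟩, h, hq⟩
      · rintro (⟨⟨hk1, hk2⟩, hq⟩ | ⟨⟨hk1, hk2⟩, h, hq⟩)
        · exact ⟨⟨hk1, hk2.trans hle⟩, hq⟩
        · exact ⟨⟨hk1, hk2⟩, hq⟩
    · rw [Finset.disjoint_left]
      intro k hk hk'
      simp only [Finset.mem_filter, Finset.mem_Icc] at hk hk'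
      omega
  rw [hsplit]
  cases c with
  | through => simp [CountConvention.last]
  | before =>
    obtain ⟨j, rfl⟩ : ∃ j, t' = j + 1 := ⟨t' - 1, by omega⟩
    have hI : Finset.Icc 1 (j + 1) = insert (j + 1) (Finset.Icc 1 j) := by
      ext k
      simp only [Finset.mem_Icc, Finset.mem_insert]
      omega
    simp only [CountConvention.last, Nat.add_sub_cancel, true_and]
    rw [hI, Finset.filter_insert]
    split_ifs
    · rw [Finset.card_insert_of_notMem (by simp)]
      omega
    · omega

variable {S A : Type*} [Fintype S] {H : ℕ}

theorem countAfter_eq {x : ℕ → Traj S A H} {s s' : S} {t' : ℕ}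
    (h : ∀ k, (s ∈ visitedBefore x k ∧ s' ∈ visitedBefore x k) ↔ t' < k)
    (p : Traj S A H → Prop) [DecidablePred fun k => t' < k ∧ p (x k)] (n : ℕ) :
    countAfter x s s' p n = ((Finset.Icc 1 n).filter fun k => t' < k ∧ p (x k)).card := by
  classical
  unfold countAfter
  congr 1
  ext k
  simp only [Finset.mem_filter, h]

theorem countAfter_mono (x : ℕ → Traj S A H) (s s' : S) {p q : Traj S A H → Prop}
    (h : ∀ o, p o → q o) (n : ℕ) : countAfter x s s' p n ≤ countAfter x s s' q n := by
  refine Finset.card_le_card fun k hk => ?_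
  simp only [Finset.mem_filter] at hk ⊢
  exact ⟨hk.1, hk.2.1, h _ hk.2.2⟩

theorem countAfter_le (x : ℕ → Traj S A H) (s s' : S) (p : Traj S A H → Prop) (n : ℕ) :
    countAfter x s s' p n ≤ n := by
  classical
  unfold countAfter
  refine (Finset.card_filter_le _ _).trans ?_
  simp

theorem mem_interval1 (M : LayeredMDP S A H) (c : CountConvention) {x : ℕ → Traj S A H} {d : ℝ}
    {t : ℕ} {s s' : S} {a : A} (hs : s ∈ visitedBefore x t) (hs' : s' ∈ visitedBefore x t)
    (hL : 1 ≤ Real.log (t / d))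
    (h : |(countAfter x s s' (fun o => VisitsSAS o s a s') (c.last t) : ℝ) -
        M.P s a s' * countAfter x s s' (fun o => VisitsSA o s a) (c.last t)| ≤
      4 * √(Real.log (t / d) * countAfter x s s' (fun o => VisitsSAS o s a s') (c.last t)) +
        12 * Real.log (t / d)) :
    M.P s a s' ∈ interval1 c x d t s a s' := by
  classical
  obtain ⟨τ, hτ, hτ1, hτt, -, hτv⟩ := exists_firstEpoch_eq hs
  obtain ⟨τ', hτ', hτ1', hτt', -, hτv'⟩ := exists_firstEpoch_eq hs'
  have ht' : (firstEpochPair x s s').toNat = max τ τ' := by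
    unfold firstEpochPair
    have : max (τ : ℕ∞) τ' = ((max τ τ' : ℕ) : ℕ∞) := by
      rcases le_total τ τ' with h | h <;> simp [h]
    rw [hτ, hτ', this]
    rfl
  have hv : ∀ k, (s ∈ visitedBefore x k ∧ s' ∈ visitedBefore x k) ↔ max τ τ' < k := by
    intro k
    rw [hτv, hτv', max_lt_iff]
  have h1 : 1 ≤ max τ τ' := le_max_of_le_left hτ1
  have h2 : max τ τ' < t := max_lt hτt hτt'
  set t' := max τ τ' with ht'def
  set v : ℝ := if c = .before ∧ VisitsSA (x t') s a then 1 else 0 with hvdef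
  set u : ℝ := if c = .before ∧ VisitsSAS (x t') s a s' then 1 else 0 with hudef
  have hu0 : 0 ≤ u := by rw [hudef]; split_ifs <;> norm_num
  have hv1 : v ≤ 1 := by rw [hvdef]; split_ifs <;> norm_num
  have huv : u ≤ v := by
    rw [hudef]
    split_ifs with hc
    · rw [hvdef, if_pos ⟨hc.1, hc.2.visitsSA⟩]
    · rw [hvdef]; split_ifs <;> norm_num
  have eN : visitN c x t s a - visitN c x t' s a =
      countAfter x s s' (fun o => VisitsSA o s a) (c.last t) + v := by
    have := card_filter_Icc_last c (fun k => VisitsSA (x k) s a) h1 h2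
    rw [← countAfter_eq hv (fun o => VisitsSA o s a)] at this
    unfold visitN countSA
    rw [this, hvdef]
    push_cast
    ring
  have eM : visitM c x t s a s' - visitM c x t' s a s' =
      countAfter x s s' (fun o => VisitsSAS o s a s') (c.last t) + u := by
    have := card_filter_Icc_last c (fun k => VisitsSAS (x k) s a s') h1 h2
    rw [← countAfter_eq hv (fun o => VisitsSAS o s a s')] at this
    unfold visitM countSAS
    rw [this, hudef]
    push_cast
    ring
  have key := abs_sub_div_le hL (M.P_nonneg s a s') (M.P_le_one s a s') (Nat.cast_nonneg _)
    (Nat.cast_le.2 (countAfter_mono x s s' (fun o h => VisitsSAS.visitsSA h) (c.last t)))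
    hu0 huv hv1 h
  rw [abs_le] at key
  simp only [interval1, width1, partialEmp, ht', eN, eM, Set.mem_Icc]
  constructor <;> linarith [key.1, key.2]

-- The hypothesis is used at `n = t(s') - 1`. In all epochs up to there `s'` is undiscovered, so its
-- probability is at most the missing mass.
open Classical in
theorem mem_interval2 (M : LayeredMDP S A H) (c : CountConvention) {x : ℕ → Traj S A H} {d : ℝ}
    (hd : 0 < d) {t : ℕ} {s s' : S} {a : A} (hs : s ∈ visitedBefore x t)
    (hs' : s' ∈ visitedBefore x t) (hL : 1 ≤ Real.log (t / d))
    (h : ∀ n, 1 ≤ n → n ≤ t →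
      ∑ k ∈ (Finset.Icc 1 n).filter (fun k => s ∈ visitedBefore x k),
        (M.missingMass (visitedBefore x k) s a / 2 * (if VisitsSA (x k) s a then 1 else 0) -
          if ∃ r, r ∉ visitedBefore x k ∧ VisitsSAS (x k) s a r then 1 else 0) ≤
        2 * Real.log (n / d)) :
    M.P s a s' ∈ interval2 c x d t s a s' := by
  have hp0 := M.P_nonneg s a s'
  have hp1 := M.P_le_one s a s'
  unfold interval2
  split_ifs with hlt
  swap
  · exact ⟨hp0, hp1⟩
  obtain ⟨τ, hτ, hτ1, hτt, -, hτv⟩ := exists_firstEpoch_eq hs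
  obtain ⟨τ', hτ', hτ1', hτt', -, hτv'⟩ := exists_firstEpoch_eq hs'
  rw [hτ, hτ'] at hlt
  have hlt' : τ + 1 ≤ τ' := by exact_mod_cast hlt
  obtain ⟨n, rfl⟩ : ∃ n, τ' = n + 1 := ⟨τ' - 1, by omega⟩
  have hn := h n (by omega) (by omega)
  set p := M.P s a s' with hp
  set N₀ : ℕ := ((Finset.Icc 1 n).filter fun k => τ < k ∧ VisitsSA (x k) s a).card with hN₀
  set V := visitedBefore x (n + 1) with hV
  -- the discovered states bound the number of discoveries
  have hnew : ∑ k ∈ (Finset.Icc 1 n).filter (fun k => s ∈ visitedBefore x k),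
      (if ∃ r, r ∉ visitedBefore x k ∧ VisitsSAS (x k) s a r then (1 : ℝ) else 0) ≤ V.card := by
    rw [Finset.sum_boole]
    refine Nat.cast_le.2 ?_
    set D := ((Finset.Icc 1 n).filter (fun k => s ∈ visitedBefore x k)).filter
      (fun k => ∃ r, r ∉ visitedBefore x k ∧ VisitsSAS (x k) s a r) with hD
    have hex : ∀ k ∈ D, ∃ r, r ∉ visitedBefore x k ∧ VisitsSAS (x k) s a r :=
      fun k hk => (Finset.mem_filter.1 hk).2
    have hmem : ∀ k ∈ D, 1 ≤ k ∧ k ≤ n := fun k hk =>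
      Finset.mem_Icc.1 (Finset.mem_filter.1 (Finset.mem_filter.1 hk).1).1
    have : Nonempty S := ⟨s⟩
    choose! r hr1 hr2 using hex
    refine Finset.card_le_card_of_injOn r (fun k hk => ?_) (fun k hk k' hk' he => ?_)
    · exact mem_visitedBefore.2
        ⟨k, (hmem k hk).1, by have := (hmem k hk).2; omega, (hr2 k hk).visits_right⟩
    · by_contra hne
      rcases lt_or_gt_of_ne hne with hl | hl
      · exact hr1 k' hk' (he ▸ mem_visitedBefore.2 ⟨k, (hmem k hk).1, hl, (hr2 k hk).visits_right⟩)
      · exact hr1 k hk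
          (he ▸ mem_visitedBefore.2 ⟨k', (hmem k' hk').1, hl, (hr2 k' hk').visits_right⟩)
  have hmass : p / 2 * N₀ ≤ ∑ k ∈ (Finset.Icc 1 n).filter (fun k => s ∈ visitedBefore x k),
      M.missingMass (visitedBefore x k) s a / 2 * (if VisitsSA (x k) s a then 1 else 0) := by
    have e : (N₀ : ℝ) = ∑ k ∈ (Finset.Icc 1 n).filter (fun k => s ∈ visitedBefore x k),
        if VisitsSA (x k) s a then (1 : ℝ) else 0 := by
      rw [Finset.sum_boole, Finset.filter_filter]
      simp only [hτv, hN₀]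
    rw [e, Finset.mul_sum]
    refine Finset.sum_le_sum fun k hk => ?_
    refine mul_le_mul_of_nonneg_right ?_ (by split_ifs <;> norm_num)
    have hk' := Finset.mem_Icc.1 (Finset.mem_filter.1 hk).1
    have : p ≤ M.missingMass (visitedBefore x k) s a := by
      refine Finset.single_le_sum (f := fun r => M.P s a r) (fun r _ => M.P_nonneg s a r) ?_
      simp only [Finset.mem_filter, Finset.mem_univ, true_and, hτv']
      omega
    linarith
  -- The two visits that `N₀` can miss occur in epoch `t(s)` and, under `through`, in epoch `t(s')`.
  have hcount : countSA x (c.last (n + 1)) s a ≤ N₀ + 2 := by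
    have h1 : countSA x (c.last (n + 1)) s a ≤
        (((Finset.Icc 1 n).filter fun k => τ < k ∧ VisitsSA (x k) s a) ∪ {τ, n + 1}).card := by
      refine Finset.card_le_card fun k hk => ?_
      simp only [Finset.mem_filter, Finset.mem_Icc, Finset.mem_union, Finset.mem_insert,
        Finset.mem_singleton] at hk ⊢
      obtain ⟨⟨hk1, hk2⟩, hk3⟩ := hk
      have hk2' : k ≤ n + 1 := by
        cases c <;> simp only [CountConvention.last] at hk2 <;> omega
      have hτk : τ ≤ k := by
        have := (hτv (k + 1)).1 (mem_visitedBefore.2 ⟨k, hk1, by omega, hk3.visits⟩)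
        omega
      by_cases hc : k = τ ∨ k = n + 1
      · exact Or.inr hc
      · exact Or.inl ⟨⟨hk1, by omega⟩, by omega, hk3⟩
    exact h1.trans ((Finset.card_union_le _ _).trans (Nat.add_le_add_left Finset.card_le_two _))
  have hlog : Real.log (n / d) ≤ Real.log (t / d) := by
    have : (0 : ℝ) < n := by exact_mod_cast (by omega : 0 < n)
    refine Real.log_le_log (by positivity) ?_
    have : (n : ℝ) ≤ t := by exact_mod_cast (by omega : n ≤ t)
    gcongr
  rw [Finset.sum_sub_distrib] at hn
  have hmain : p * N₀ ≤ 2 * V.card + 4 * Real.log (t / d) := by linarith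
  have hcount' : visitN c x (n + 1) s a - 1 ≤ N₀ + 1 := by
    have : (countSA x (c.last (n + 1)) s a : ℝ) ≤ N₀ + 2 := by exact_mod_cast hcount
    unfold visitN
    linarith
  have ht' : (firstEpoch x s').toNat = n + 1 := by
    rw [hτ']
    rfl
  simp only [width2, ht', Set.mem_Icc]
  refine ⟨hp0, ?_⟩
  rw [le_div_iff₀ (by positivity)]
  have hVn : (0 : ℝ) ≤ V.card := Nat.cast_nonneg _
  -- Either way the surplus is at most `p ≤ 1 ≤ Real.log (t / d)`, which the constant 24 covers.
  rcases max_cases (visitN c x (n + 1) s a - 1) 1 with ⟨hm, -⟩ | ⟨hm, -⟩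
  · rw [hm]
    nlinarith
  · rw [hm]
    linarith

end Counting

/-! ### The pruned transition function. -/

section Pruning

variable {S A : Type*} [Fintype S] {H : ℕ}

theorem LayeredMDP.isPrunedTransition_prunedP (M : LayeredMDP S A H) (B : Finset S) :
    M.IsPrunedTransition B (M.prunedP B) := by
  classical
  refine ⟨?_, ?_, ?_⟩
  · rintro (s | h) a (s' | h')
    · exact M.P_nonneg _ _ _
    · simp only [prunedP]
      split_ifs with hh
      · have h1 := M.P_sum s.1 a (by have := h'.2; omega)
        have h2 : ∑ r ∈ B.filter (fun r => (M.layer r : ℕ) = M.layer s.1 + 1), M.P s.1 a r ≤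
            ∑ r, M.P s.1 a r :=
          Finset.sum_le_sum_of_subset_of_nonneg (Finset.subset_univ _)
            fun r _ _ => M.P_nonneg _ _ _
        linarith
      · exact le_rfl
    · exact le_rfl
    · simp only [prunedP]
      split_ifs <;> norm_num
  · rintro (s | h) a (s' | h') hne
    · exact M.P_layer _ _ _ hne
    · simp only [prunedP] at hne
      by_contra hc
      exact hne (if_neg hc)
    · exact absurd rfl hne
    · simp only [prunedP] at hne
      by_contra hc
      exact hne (if_neg hc)
  · rintro (s | h) a hlt
    · simp only [prunedLayer] at hlt
      rw [Fintype.sum_sum_type]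
      simp only [prunedP]
      have e1 : ∑ r : {r // r ∈ B}, M.P s.1 a r.1 =
          ∑ r ∈ B.filter (fun r => (M.layer r : ℕ) = M.layer s.1 + 1), M.P s.1 a r := by
        rw [Finset.sum_coe_sort B (fun r => M.P s.1 a r)]
        refine (Finset.sum_filter_of_ne fun r _ hr => ?_).symm
        exact M.P_layer _ _ _ hr
      rw [Finset.sum_eq_single (⟨M.layer s.1 + 1, hlt⟩ : Fin H), if_pos rfl, e1]
      · ring
      · intro h' _ hne
        exact if_neg fun he => hne (Fin.ext he)
      · simp
    · simp only [prunedLayer] at hlt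
      rw [Fintype.sum_sum_type]
      simp only [prunedP, Finset.sum_const_zero, zero_add]
      rw [Finset.sum_eq_single (⟨h + 1, hlt⟩ : Fin H), if_pos rfl]
      · intro h' _ hne
        exact if_neg fun he => hne (Fin.ext he)
      · simp

theorem LayeredMDP.prunedP_mem_confSet (M : LayeredMDP S A H) {c : CountConvention}
    {x : ℕ → Traj S A H} {d₁ : S → A → S → ℝ} {d₂ : S → A → ℝ} {t : ℕ} {B : Finset S}
    (h : ∀ s ∈ B, ∀ a, ∀ s' ∈ B, (M.layer s' : ℕ) = M.layer s + 1 →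
      M.P s a s' ∈ interval1 c x (d₁ s a s') t s a s' ∩ interval2 c x (d₂ s a) t s a s') :
    M.prunedP B ∈ M.confSet c x d₁ d₂ t B := by
  refine ⟨M.isPrunedTransition_prunedP B, fun s a s' hl => h s.1 s.2 a s'.1 s'.2 hl, ?_⟩
  rintro h a (s' | h') hl
  · exact ⟨fun hc => by simp at hc, fun _ => rfl⟩
  · exact ⟨fun _ => if_pos hl, fun hc => by simp at hc⟩

end Pruning

/-! ### Union bounds over indices, actions and epochs. -/

section UnionBounds

theorem exp_neg_mul_log (k : ℕ) {y d : ℝ} (hy : 0 < y) (hd : 0 < d) :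
    Real.exp (-(k * Real.log (y / d))) = (d / y) ^ k := by
  rw [← mul_neg, ← Real.log_inv, inv_div, Real.exp_nat_mul, Real.exp_log (by positivity)]

theorem one_le_log_div {y d : ℝ} (hy : 1 ≤ y) (hd : 0 < d) (hd1 : d ≤ 1 / 4) :
    1 ≤ Real.log (y / d) := by
  rw [Real.le_log_iff_exp_le (by positivity), le_div_iff₀ hd]
  have := Real.exp_one_lt_d9
  nlinarith

/-- An inequality, so that an empty action set is covered. -/
theorem natCast_mul_div_le (n : ℕ) {y : ℝ} (hy : 0 ≤ y) : (n : ℝ) * (y / n) ≤ y := by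
  rcases eq_or_ne (n : ℝ) 0 with h | h
  · rw [h, zero_mul]
    exact hy
  · exact (mul_div_cancel₀ y h).le

variable {S A : Type*} [Fintype S] [Fintype A] {H : ℕ} {Ω : Type*} {mΩ : MeasurableSpace Ω}
  {M : LayeredMDP S A H} {T : ℕ} {μ : Measure Ω} [IsProbabilityMeasure μ]
  {𝓕 : Filtration ℕ mΩ} {π : ℕ → Ω → S → A → ℝ} {x : ℕ → Ω → Traj S A H}

theorem card_nonempty_ge_one (a : A) : (1 : ℝ) ≤ Fintype.card A := by
  exact_mod_cast Fintype.card_pos_iff.2 ⟨a⟩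

/-- `2 i² j² ≤ i⁴ + j⁴` makes the levels summable over pairs of indices. -/
theorem pairLevel_bounds {δ : ℝ} (hδ : 0 < δ) (hδ1 : δ < 1) {i j : ℕ} (hi : 1 ≤ i) (hj : 1 ≤ j)
    (a : A) :
    0 < δ / (4 * ((i : ℝ) ^ 4 + (j : ℝ) ^ 4) * Fintype.card A) ∧
    δ / (4 * ((i : ℝ) ^ 4 + (j : ℝ) ^ 4) * Fintype.card A) ≤ 1 / 8 ∧
    δ / (4 * ((i : ℝ) ^ 4 + (j : ℝ) ^ 4) * Fintype.card A) ≤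
      δ / 8 * (1 / (i : ℝ) ^ 2) * (1 / (j : ℝ) ^ 2) / Fintype.card A := by
  have hA := card_nonempty_ge_one a
  have hi' : (1 : ℝ) ≤ i := by exact_mod_cast hi
  have hj' : (1 : ℝ) ≤ j := by exact_mod_cast hj
  have hi4 : (1 : ℝ) ≤ (i : ℝ) ^ 4 := one_le_pow₀ hi'
  have hj4 : (1 : ℝ) ≤ (j : ℝ) ^ 4 := one_le_pow₀ hj'
  refine ⟨by positivity, ?_, ?_⟩
  · rw [div_le_div_iff₀ (by positivity) (by norm_num)]
    nlinarith
  · have e : δ / 8 * (1 / (i : ℝ) ^ 2) * (1 / (j : ℝ) ^ 2) / Fintype.card A =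
        δ / (8 * (i : ℝ) ^ 2 * (j : ℝ) ^ 2 * Fintype.card A) := by field_simp
    rw [e]
    refine div_le_div_of_nonneg_left hδ.le (by positivity) ?_
    refine mul_le_mul_of_nonneg_right ?_ (by positivity)
    nlinarith [sq_nonneg ((i : ℝ) ^ 2 - (j : ℝ) ^ 2)]

theorem stateLevel_bounds {δ : ℝ} (hδ : 0 < δ) (hδ1 : δ < 1) {i : ℕ} (hi : 1 ≤ i) (a : A) :
    0 < δ / (4 * (i : ℝ) ^ 2 * Fintype.card A) ∧
    δ / (4 * (i : ℝ) ^ 2 * Fintype.card A) ≤ 1 / 4 := by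
  have hA := card_nonempty_ge_one a
  have hi' : (1 : ℝ) ≤ i := by exact_mod_cast hi
  have hi2 : (1 : ℝ) ≤ (i : ℝ) ^ 2 := one_le_pow₀ hi'
  refine ⟨by positivity, ?_⟩
  rw [div_le_div_iff₀ (by positivity) (by norm_num)]
  nlinarith

/-- With high probability, all transition counts between visited states concentrate. -/
theorem IsInteraction.measureReal_exists_transition_deviation_le
    (hx : IsInteraction M T μ 𝓕 π x) {δ : ℝ} (hδ : 0 < δ) (hδ1 : δ < 1) (c : CountConvention) :
    μ.real {ω | ∃ t s s' a, 1 ≤ t ∧ t ≤ T ∧ s ∈ visitedBefore (fun τ => x τ ω) t ∧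
        s' ∈ visitedBefore (fun τ => x τ ω) t ∧ (M.layer s' : ℕ) = M.layer s + 1 ∧
        4 * √(Real.log (t / levelSAS δ (fun τ => x τ ω) s a s') *
            countAfter (fun τ => x τ ω) s s' (fun o => VisitsSAS o s a s') (c.last t)) +
          12 * Real.log (t / levelSAS δ (fun τ => x τ ω) s a s') <
        |(countAfter (fun τ => x τ ω) s s' (fun o => VisitsSAS o s a s') (c.last t) : ℝ) -
          M.P s a s' * countAfter (fun τ => x τ ω) s s' (fun o => VisitsSA o s a) (c.last t)|} ≤
      δ / 4 := by
  classical
  set K := Fintype.card S with hK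
  set d : ℕ → ℕ → ℝ := fun i j => δ / (4 * ((i : ℝ) ^ 4 + (j : ℝ) ^ 4) * Fintype.card A) with hd
  -- The tilt must not depend on the realized visit count, so `ν` ranges over all its possible
  -- values; `σ = ±1` selects the tail. The factor 3 gives `(d / t)³`: one power of `t` pays for the
  -- choice of `ν`, the other two make the sum over `t` converge.
  set E : ℕ → ℕ → A → ℕ → ℕ → ℝ → Set Ω := fun i j a t ν σ =>
    {ω | ∃ t' s s', (s ∈ visitedBefore (fun τ => x τ ω) t' ∧
        s' ∈ visitedBefore (fun τ => x τ ω) t') ∧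
        arrivalIndex (fun τ => x τ ω) s = i ∧ arrivalIndex (fun τ => x τ ω) s' = j ∧
        (M.layer s' : ℕ) = M.layer s + 1 ∧
        3 * Real.log (t / d i j) ≤
          (fun p => σ * tiltParam (3 * Real.log (t / d i j)) ν p) (M.P s a s') *
            countAfter (fun τ => x τ ω) s s' (fun o => VisitsSAS o s a s') (c.last t) -
          ((fun p => σ * tiltParam (3 * Real.log (t / d i j)) ν p) (M.P s a s') +
            (fun p => σ * tiltParam (3 * Real.log (t / d i j)) ν p) (M.P s a s') ^ 2) *
            M.P s a s' *
            countAfter (fun τ => x τ ω) s s' (fun o => VisitsSA o s a) (c.last t)} with hE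
  have hlast : ∀ t, c.last t ≤ t := fun t => by cases c <;> simp [CountConvention.last]
  have hEle : ∀ i ∈ Finset.Icc 1 K, ∀ j ∈ Finset.Icc 1 K, ∀ a, ∀ t ∈ Finset.Icc 1 T, ∀ ν,
      ∀ σ ∈ ({1, -1} : Finset ℝ), μ.real (E i j a t ν σ) ≤ (d i j / t) ^ 3 := by
    intro i hi j hj a t ht ν σ hσ
    rw [Finset.mem_Icc] at hi hj ht
    obtain ⟨h1, h2, -⟩ := pairLevel_bounds hδ hδ1 hi.1 hj.1 a
    have ht1 : (1 : ℝ) ≤ t := by exact_mod_cast ht.1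
    have hL := one_le_log_div ht1 h1 (h2.trans (by norm_num))
    refine (hx.measureReal_transition_tail_le i j a
      (l := fun p => σ * tiltParam (3 * Real.log (t / d i j)) ν p) (fun p => ?_) (c.last t)
      ((hlast t).trans ht.2) _).trans_eq (exp_neg_mul_log 3 (by linarith) h1)
    have hσ' : |σ| = 1 := by
      simp only [Finset.mem_insert, Finset.mem_singleton] at hσ
      rcases hσ with rfl | rfl <;> simp
    rw [abs_mul, hσ', one_mul, abs_of_nonneg (tiltParam_nonneg _ _ _)]
    exact tiltParam_le_one (by simp only [hd]; linarith) _ _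
  refine (measureReal_mono (s₂ := ⋃ i ∈ Finset.Icc 1 K, ⋃ j ∈ Finset.Icc 1 K, ⋃ a ∈ (Finset.univ : Finset A),
        ⋃ t ∈ Finset.Icc 1 T, ⋃ ν ∈ Finset.range (t + 1), ⋃ σ ∈ ({1, -1} : Finset ℝ),
          E i j a t ν σ)
      ?_ (measure_ne_top _ _)).trans ?_
  · rintro ω ⟨t, s, s', a, ht1, htT, hs, hs', hlay, hdev⟩
    set y := fun τ => x τ ω with hy
    set m₀ := countAfter y s s' (fun o => VisitsSAS o s a s') (c.last t) with hm₀
    set ν := countAfter y s s' (fun o => VisitsSA o s a) (c.last t) with hν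
    set p := M.P s a s' with hp
    have hi := Finset.mem_Icc.2 ⟨one_le_arrivalIndex y s, arrivalIndex_le_card y s⟩
    have hj := Finset.mem_Icc.2 ⟨one_le_arrivalIndex y s', arrivalIndex_le_card y s'⟩
    have hνt : ν ∈ Finset.range (t + 1) :=
      Finset.mem_range.2 (Nat.lt_succ_of_le ((countAfter_le _ _ _ _ _).trans (hlast t)))
    obtain ⟨h1, h2, -⟩ := pairLevel_bounds hδ hδ1 (one_le_arrivalIndex y s)
      (one_le_arrivalIndex y s') a
    have hL := one_le_log_div (by exact_mod_cast ht1 : (1 : ℝ) ≤ t) h1 (h2.trans (by norm_num))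
    change 4 * √(Real.log (t / d (arrivalIndex y s) (arrivalIndex y s')) * m₀) +
      12 * Real.log (t / d (arrivalIndex y s) (arrivalIndex y s')) < _ at hdev
    change 1 ≤ Real.log (t / d (arrivalIndex y s) (arrivalIndex y s')) at hL
    by_contra hnot
    have hneg : ∀ σ ∈ ({1, -1} : Finset ℝ),
        ω ∉ E (arrivalIndex y s) (arrivalIndex y s') a t ν σ := by
      intro σ hσ hmem
      refine hnot ?_
      simp only [Set.mem_iUnion]
      exact ⟨_, hi, _, hj, a, Finset.mem_univ a, t, Finset.mem_Icc.2 ⟨ht1, htT⟩, ν, hνt, σ, hσ,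
        hmem⟩
    have hineq : ∀ σ ∈ ({1, -1} : Finset ℝ),
        σ * tiltParam (3 * Real.log (t / d (arrivalIndex y s) (arrivalIndex y s'))) ν p * m₀ -
        (σ * tiltParam (3 * Real.log (t / d (arrivalIndex y s) (arrivalIndex y s'))) ν p +
        (σ * tiltParam (3 * Real.log (t / d (arrivalIndex y s) (arrivalIndex y s'))) ν p) ^ 2) *
          p * ν < 3 * Real.log (t / d (arrivalIndex y s) (arrivalIndex y s')) := by
      intro σ hσ
      by_contra! hc
      exact hneg σ hσ ⟨t, s, s', ⟨hs, hs'⟩, rfl, rfl, hlay, hc⟩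
    have hpos := hineq 1 (by simp)
    have hmin := hineq (-1) (by simp)
    refine absurd (abs_sub_le_of_tilted (p := p) (ν := ν) (m := m₀) (by linarith)
      (Nat.cast_nonneg _) ?_) (not_le.2 hdev)
    set l := tiltParam (3 * Real.log (t / d (arrivalIndex y s) (arrivalIndex y s'))) ν p with hl
    have hl0 : 0 ≤ l := tiltParam_nonneg _ _ _
    rcases abs_cases ((m₀ : ℝ) - p * ν) with ⟨ha, -⟩ | ⟨ha, -⟩
    · rw [ha]; nlinarith
    · rw [ha]; nlinarith
  have htime : ∀ i ∈ Finset.Icc 1 K, ∀ j ∈ Finset.Icc 1 K, ∀ a,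
      μ.real (⋃ t ∈ Finset.Icc 1 T, ⋃ ν ∈ Finset.range (t + 1), ⋃ σ ∈ ({1, -1} : Finset ℝ),
          E i j a t ν σ) ≤ δ / 64 * (1 / (i : ℝ) ^ 2) * (1 / (j : ℝ) ^ 2) / Fintype.card A := by
    intro i hi j hj a
    obtain ⟨h1, h2, h3⟩ := pairLevel_bounds hδ hδ1 (Finset.mem_Icc.1 hi).1 (Finset.mem_Icc.1 hj).1 a
    have hstep : ∀ t ∈ Finset.Icc 1 T, μ.real (⋃ ν ∈ Finset.range (t + 1),
        ⋃ σ ∈ ({1, -1} : Finset ℝ), E i j a t ν σ) ≤ 4 * d i j ^ 3 * (1 / (t : ℝ) ^ 2) := by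
      intro t ht
      have ht1 : (1 : ℝ) ≤ t := by exact_mod_cast (Finset.mem_Icc.1 ht).1
      calc _ ≤ ∑ ν ∈ Finset.range (t + 1), ∑ σ ∈ ({1, -1} : Finset ℝ), (d i j / t) ^ 3 :=
            (measureReal_biUnion_finset_le _ _).trans (Finset.sum_le_sum fun ν _ =>
              (measureReal_biUnion_finset_le _ _).trans (Finset.sum_le_sum fun σ hσ =>
                hEle i hi j hj a t ht ν σ hσ))
        _ = (t + 1) * (2 * (d i j / t) ^ 3) := by
            rw [Finset.sum_const, Finset.sum_const, Finset.card_range,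
              Finset.card_pair (by norm_num)]
            simp
        _ ≤ (2 * t) * (2 * (d i j / t) ^ 3) := by
            refine mul_le_mul_of_nonneg_right (by linarith) ?_
            have : 0 < d i j := h1
            positivity
        _ = 4 * d i j ^ 3 * (1 / (t : ℝ) ^ 2) := by
            field_simp
            ring
    calc _ ≤ ∑ t ∈ Finset.Icc 1 T, 4 * d i j ^ 3 * (1 / (t : ℝ) ^ 2) :=
          (measureReal_biUnion_finset_le _ _).trans (Finset.sum_le_sum hstep)
      _ = 4 * d i j ^ 3 * ∑ t ∈ Finset.Icc 1 T, 1 / (t : ℝ) ^ 2 := by rw [Finset.mul_sum]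
      _ ≤ 4 * d i j ^ 3 * 2 := by
          refine mul_le_mul_of_nonneg_left (sum_one_div_sq_le_two T) ?_
          have : 0 < d i j := h1
          positivity
      _ ≤ d i j / 8 := by
          have h0 : 0 < d i j := h1
          have h8 : d i j ≤ 1 / 8 := h2
          have : d i j ^ 2 ≤ (1 / 8) ^ 2 := pow_le_pow_left₀ h0.le h8 2
          nlinarith
      _ ≤ (δ / 8 * (1 / (i : ℝ) ^ 2) * (1 / (j : ℝ) ^ 2) / Fintype.card A) / 8 :=
          div_le_div_of_nonneg_right h3 (by norm_num)
      _ = _ := by ring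
  have hact : ∀ i ∈ Finset.Icc 1 K, ∀ j ∈ Finset.Icc 1 K,
      μ.real (⋃ a ∈ (Finset.univ : Finset A), ⋃ t ∈ Finset.Icc 1 T, ⋃ ν ∈ Finset.range (t + 1),
        ⋃ σ ∈ ({1, -1} : Finset ℝ), E i j a t ν σ) ≤
        δ / 64 * (1 / (i : ℝ) ^ 2) * (1 / (j : ℝ) ^ 2) := by
    intro i hi j hj
    refine (measureReal_biUnion_finset_le _ _).trans
      ((Finset.sum_le_sum fun a _ => htime i hi j hj a).trans ?_)
    rw [Finset.sum_const, Finset.card_univ, nsmul_eq_mul]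
    exact natCast_mul_div_le _ (by positivity)
  calc _ ≤ ∑ i ∈ Finset.Icc 1 K, ∑ j ∈ Finset.Icc 1 K,
        δ / 64 * (1 / (i : ℝ) ^ 2) * (1 / (j : ℝ) ^ 2) :=
        (measureReal_biUnion_finset_le _ _).trans (Finset.sum_le_sum fun i hi =>
          (measureReal_biUnion_finset_le _ _).trans (Finset.sum_le_sum fun j hj => hact i hi j hj))
    _ = δ / 64 * ((∑ i ∈ Finset.Icc 1 K, 1 / (i : ℝ) ^ 2) *
          ∑ j ∈ Finset.Icc 1 K, 1 / (j : ℝ) ^ 2) := by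
        rw [Finset.sum_mul_sum, Finset.mul_sum]
        refine Finset.sum_congr rfl fun i _ => ?_
        rw [Finset.mul_sum]
        exact Finset.sum_congr rfl fun j _ => by ring
    _ ≤ δ / 64 * (2 * 2) := by
        refine mul_le_mul_of_nonneg_left ?_ (by positivity)
        exact mul_le_mul (sum_one_div_sq_le_two K) (sum_one_div_sq_le_two K)
          (Finset.sum_nonneg fun j _ => by positivity) (by norm_num)
    _ ≤ δ / 4 := by linarith

open Classical in
/-- With high probability, the missing mass at all visited states is controlled by the number of
discoveries. -/
theorem IsInteraction.measureReal_exists_missingMass_deviation_le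
    (hx : IsInteraction M T μ 𝓕 π x) {δ : ℝ} (hδ : 0 < δ) (hδ1 : δ < 1) :
    μ.real {ω | ∃ n t s a, 1 ≤ n ∧ n ≤ T ∧ s ∈ visitedBefore (fun τ => x τ ω) t ∧
        (M.layer s : ℕ) + 1 < H ∧ 2 * Real.log (n / levelSA δ (fun τ => x τ ω) s a) <
        ∑ k ∈ (Finset.Icc 1 n).filter (fun k => s ∈ visitedBefore (fun τ => x τ ω) k),
          (M.missingMass (visitedBefore (fun τ => x τ ω) k) s a / 2 *
            (if VisitsSA (x k ω) s a then 1 else 0) -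
          if ∃ r, r ∉ visitedBefore (fun τ => x τ ω) k ∧ VisitsSAS (x k ω) s a r
            then 1 else 0)} ≤ δ / 2 := by
  set K := Fintype.card S with hK
  set d : ℕ → ℝ := fun i => δ / (4 * (i : ℝ) ^ 2 * Fintype.card A) with hd
  -- No visit count has to be guessed here, so the factor 2, which yields `(d / n)²`, suffices.
  set E : ℕ → A → ℕ → Set Ω := fun i a n =>
    {ω | ∃ t s, s ∈ visitedBefore (fun τ => x τ ω) t ∧
        arrivalIndex (fun τ => x τ ω) s = i ∧ (M.layer s : ℕ) + 1 < H ∧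
        2 * Real.log (n / d i) ≤
        ∑ k ∈ (Finset.Icc 1 n).filter (fun k => s ∈ visitedBefore (fun τ => x τ ω) k),
          (M.missingMass (visitedBefore (fun τ => x τ ω) k) s a / 2 *
            (if VisitsSA (x k ω) s a then 1 else 0) -
          if ∃ r, r ∉ visitedBefore (fun τ => x τ ω) k ∧ VisitsSAS (x k ω) s a r
            then 1 else 0)} with hE
  refine (measureReal_mono (s₂ := ⋃ i ∈ Finset.Icc 1 K, ⋃ a ∈ (Finset.univ : Finset A), ⋃ n ∈ Finset.Icc 1 T, E i a n)
      ?_ (measure_ne_top _ _)).trans ?_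
  · rintro ω ⟨n, t, s, a, hn1, hnT, hs, hlay, hb⟩
    simp only [Set.mem_iUnion]
    exact ⟨_, Finset.mem_Icc.2 ⟨one_le_arrivalIndex _ s, arrivalIndex_le_card _ s⟩, a,
      Finset.mem_univ a, n, Finset.mem_Icc.2 ⟨hn1, hnT⟩, t, s, hs, rfl, hlay, hb.le⟩
  have htime : ∀ i ∈ Finset.Icc 1 K, ∀ a,
      μ.real (⋃ n ∈ Finset.Icc 1 T, E i a n) ≤ δ / 4 * (1 / (i : ℝ) ^ 2) / Fintype.card A := by
    intro i hi a
    obtain ⟨h1, h2⟩ := stateLevel_bounds hδ hδ1 (Finset.mem_Icc.1 hi).1 a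
    have hstep : ∀ n ∈ Finset.Icc 1 T, μ.real (E i a n) ≤ d i ^ 2 * (1 / (n : ℝ) ^ 2) := by
      intro n hn
      rw [Finset.mem_Icc] at hn
      have hn1 : (1 : ℝ) ≤ n := by exact_mod_cast hn.1
      rw [mul_one_div, ← div_pow, ← exp_neg_mul_log 2 (by linarith) h1]
      exact hx.measureReal_missingMass_tail_le i a n hn.2 _
    calc _ ≤ ∑ n ∈ Finset.Icc 1 T, d i ^ 2 * (1 / (n : ℝ) ^ 2) :=
          (measureReal_biUnion_finset_le _ _).trans (Finset.sum_le_sum hstep)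
      _ = d i ^ 2 * ∑ n ∈ Finset.Icc 1 T, 1 / (n : ℝ) ^ 2 := by rw [Finset.mul_sum]
      _ ≤ d i ^ 2 * 2 := mul_le_mul_of_nonneg_left (sum_one_div_sq_le_two T) (sq_nonneg _)
      _ ≤ d i := by
          have h0 : 0 < d i := h1
          have h4 : d i ≤ 1 / 4 := h2
          nlinarith
      _ = _ := by
          simp only [hd]
          field_simp
  have hact : ∀ i ∈ Finset.Icc 1 K, μ.real (⋃ a ∈ (Finset.univ : Finset A),
      ⋃ n ∈ Finset.Icc 1 T, E i a n) ≤ δ / 4 * (1 / (i : ℝ) ^ 2) := by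
    intro i hi
    refine (measureReal_biUnion_finset_le _ _).trans
      ((Finset.sum_le_sum fun a _ => htime i hi a).trans ?_)
    rw [Finset.sum_const, Finset.card_univ, nsmul_eq_mul]
    exact natCast_mul_div_le _ (by positivity)
  calc _ ≤ ∑ i ∈ Finset.Icc 1 K, δ / 4 * (1 / (i : ℝ) ^ 2) :=
        (measureReal_biUnion_finset_le _ _).trans (Finset.sum_le_sum hact)
    _ = δ / 4 * ∑ i ∈ Finset.Icc 1 K, 1 / (i : ℝ) ^ 2 := by rw [Finset.mul_sum]
    _ ≤ δ / 4 * 2 := mul_le_mul_of_nonneg_left (sum_one_div_sq_le_two K) (by positivity)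
    _ = δ / 2 := by ring

end UnionBounds

end StateFreeRL

/-- With probability at least `1 - δ`, at every epoch `t ∈ [T]` the true transition function
on the pruned space of `SF-RL` lies in the confidence set, and so does, simultaneously, the one on
every pruned space whose non-auxiliary states have been visited before epoch `t`. -/
theorem lemma4 {S A Ω : Type*} [Fintype S] [Fintype A] {mΩ : MeasurableSpace Ω} {H : ℕ}
    (M : StateFreeRL.LayeredMDP S A H) (T : ℕ)
    (μ : MeasureTheory.Measure Ω) [MeasureTheory.IsProbabilityMeasure μ]
    (𝓕 : MeasureTheory.Filtration ℕ mΩ) (π : ℕ → Ω → S → A → ℝ)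
    (x : ℕ → Ω → StateFreeRL.Traj S A H)
    (hx : StateFreeRL.IsInteraction M T μ 𝓕 π x)
    (δ ε : ℝ) (hδ : 0 < δ) (hδ1 : δ < 1) (hε : 0 ≤ ε)
    (c : StateFreeRL.CountConvention) :
    ENNReal.ofReal (1 - δ) ≤ μ {ω | ∀ t : ℕ, 1 ≤ t → t ≤ T →
      M.prunedP (StateFreeRL.sfrlStatesAt δ ε (fun τ => x τ ω) t) ∈
        M.confSet c (fun τ => x τ ω) (StateFreeRL.levelSAS δ fun τ => x τ ω)
          (StateFreeRL.levelSA δ fun τ => x τ ω) t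
          (StateFreeRL.sfrlStatesAt δ ε (fun τ => x τ ω) t) ∧
      ∀ B : Finset S, B ⊆ StateFreeRL.visitedBefore (fun τ => x τ ω) t →
        M.prunedP B ∈
          M.confSet c (fun τ => x τ ω) (StateFreeRL.levelSAS δ fun τ => x τ ω)
            (StateFreeRL.levelSA δ fun τ => x τ ω) t B} := by
  classical
  set bad₁ : Set Ω := _
  set bad₂ : Set Ω := _
  have h₁ : μ.real bad₁ ≤ δ / 4 :=
    hx.measureReal_exists_transition_deviation_le hδ hδ1 c
  have h₂ : μ.real bad₂ ≤ δ / 2 := hx.measureReal_exists_missingMass_deviation_le hδ hδ1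
  set good : Set Ω := _
  change ENNReal.ofReal (1 - δ) ≤ μ good
  have hcover : (bad₁ ∪ bad₂)ᶜ ⊆ good := by
    intro ω hω
    rw [Set.compl_union] at hω
    set y := fun τ => x τ ω with hy
    have main : ∀ t : ℕ, 1 ≤ t → t ≤ T → ∀ B : Finset S, B ⊆ StateFreeRL.visitedBefore y t →
        M.prunedP B ∈ M.confSet c y (StateFreeRL.levelSAS δ y) (StateFreeRL.levelSA δ y) t B := by
      intro t ht1 htT B hB
      refine M.prunedP_mem_confSet fun s hs a s' hs' hlay => ?_
      have ht : (1 : ℝ) ≤ t := by exact_mod_cast ht1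
      have hlay' : (M.layer s : ℕ) + 1 < H := by have := (M.layer s').2; omega
      obtain ⟨hd₁, hd₁', -⟩ := StateFreeRL.pairLevel_bounds hδ hδ1
        (StateFreeRL.one_le_arrivalIndex y s) (StateFreeRL.one_le_arrivalIndex y s') a
      obtain ⟨hd₂, hd₂'⟩ := StateFreeRL.stateLevel_bounds hδ hδ1
        (StateFreeRL.one_le_arrivalIndex y s) a
      constructor
      · refine StateFreeRL.mem_interval1 M c (hB hs) (hB hs')
          (StateFreeRL.one_le_log_div ht hd₁ (hd₁'.trans (by norm_num))) ?_
        by_contra! hc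
        exact hω.1 ⟨t, s, s', a, ht1, htT, hB hs, hB hs', hlay, hc⟩
      · refine StateFreeRL.mem_interval2 M c hd₂ (hB hs) (hB hs')
          (StateFreeRL.one_le_log_div ht hd₂ hd₂') fun n hn1 hnt => ?_
        by_contra! hc
        exact hω.2 ⟨n, t, s, a, hn1, hnt.trans htT, hB hs, hlay', hc⟩
    intro t ht1 htT
    refine ⟨main t ht1 htT _ ?_, main t ht1 htT⟩
    have := StateFreeRL.sfrlStates_subset M.horizon_pos hδ hδ1 hε y (t - 1)
    rwa [Nat.sub_add_cancel ht1] at this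
  have hbad : μ.real (bad₁ ∪ bad₂) ≤ δ := by
    have := measureReal_union_le (μ := μ) bad₁ bad₂
    linarith
  -- Subadditivity of the outer measure replaces complementation, so none of these sets has to be
  -- shown measurable.
  have hone : (1 : ℝ) ≤ μ.real good + μ.real (bad₁ ∪ bad₂) := by
    rw [← probReal_univ (μ := μ)]
    refine (measureReal_mono ?_).trans (measureReal_union_le _ _)
    intro ω _
    by_cases hω : ω ∈ bad₁ ∪ bad₂
    · exact Or.inr hω
    · exact Or.inl (hcover hω)
  rw [ENNReal.ofReal_le_iff_le_toReal (measure_ne_top _ _)]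
  change 1 - δ ≤ μ.real good
  linarith
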